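/- Conventions. For $m\ge 0$, a formula in prenex normal form is $\Sigma_m$ (resp. $\Pi_m$) if its quantifier prefix consists of at most $m$ blocks of like quantifiers and the first block, if there is one, is existential (resp. universal). For $n\ge1$ let $\sigma_n$ be the vocabulary with binary relation symbols $\le$, $S_i,R_i$ ($1\le i\le n$) and unary relation symbols $P_i$ ($2\le i\le n$). Write $x<y$ for $x\le y\wedge x\ne y$, and let $\mathrm{NLO}$ be the sentence saying that $\le$ is not a linear order. For a sentence $\theta$ let $\theta^{[x,y]}$ be $x\le y$ in conjunction with the formula obtained from $\theta$ by relativizing every quantifier to $\{z : x\le z\wedge z\le y\}$. Define $$\mathrm{PartialSucc}_1:=\forall x\forall y\,\bigl(S_1(x,y)\to x<y\wedge\forall z(z\le x\vee y\le z)\bigr),$$ $$\mathrm{Total}_1(x,y):=x<y\wedge\forall z\bigl(x\le z\wedge z<y\to\exists w(z<w\wedge w\le y\wedge S_1(z,w))\bigr),$$ for $n\ge 2$ $$\mathrm{Succ}_n(x,y):=P_n(x)\wedge P_n(y)\wedge S_n(x,y)\wedge \mathrm{SomeTotalR}_{n-1}^{[x,y]},$$ $$\mathrm{PartialSucc}_n:=\forall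 x\forall y\,\bigl(\mathrm{Succ}_n(x,y)\to\forall z(P_n(z)\to z\le x\vee y\le z)\bigr),$$ $$\mathrm{Total}_n(x,y):=P_n(x)\wedge x<y\wedge\forall z\bigl(P_n(z)\wedge x\le z\wedge z<y\to\exists w(z<w\wedge w\le y\wedge\mathrm{Succ}_n(z,w))\bigr),$$ and for $n\ge1$ $$\mathrm{SomeTotalR}_n:=\neg\mathrm{PartialSucc}_n\vee\exists x\exists y\,\bigl(R_n(x,y)\wedge\mathrm{Total}_n(x,y)\bigr).$$ Let $a,b$ be two new constant symbols and let $$\phi_n:=\mathrm{NLO}\vee\neg\mathrm{PartialSucc}_n\vee\bigl(R_n(a,b)\wedge\mathrm{Total}_n(a,b)\bigr),$$ the sentence over $\sigma_n\cup\{a,b\}$ obtained from $\mathrm{NLO}\vee\mathrm{SomeTotalR}_n$ by removing the two outer existential quantifiers and replacing the resulting free variables by $a$ and $b$. Theorem. For every $n\ge 1$, $\phi_n$ is logically equivalent to a $\Pi_{2n}$ sentence $\phi$ over $\sigma_n\cup\{a,b\}$ such that the class of finite models of $\phi$ is closed under extensions, and $\phi$ is not equivalent over finite structures to any $\Sigma_{2n}$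 sentence over $\sigma_n\cup\{a,b\}$. In fact no $\Sigma_{2n}$ sentence is equivalent to $\phi$ even over those finite structures in which $\le$ is a linear order with minimum $a$ and maximum $b$. In particular, for every even number $m>1$ there is a $\Pi_m$ sentence whose finite models are closed under extensions and which is not equivalent in the finite to any $\Sigma_m$ sentence. -/

import Mathlib

open FirstOrder FirstOrder.Language

namespace ExtPres

/-! ### Prefix classes and properties of sentences over finite structures -/

/-- `PrefixClass b n φ`: the formula `φ` is in prenex normal form and its quantifier prefix consists
of at most `n` blocks, the first of which (if there is one) is existential for `b = true` and
universal for `b = false`. -/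
inductive PrefixClass {L : FirstOrder.Language.{0, 0}} {α : Type} :
    Bool → ℕ → ∀ {m : ℕ}, L.BoundedFormula α m → Prop
  | qf {b : Bool} {n m : ℕ} {φ : L.BoundedFormula α m} (h : φ.IsQF) : PrefixClass b n φ
  | ex {n m : ℕ} {φ : L.BoundedFormula α (m + 1)} (h : PrefixClass true (n + 1) φ) :
      PrefixClass true (n + 1) φ.ex
  | exSwitch {n m : ℕ} {φ : L.BoundedFormula α (m + 1)} (h : PrefixClass false n φ) :
      PrefixClass true (n + 1) φ.ex
  | all {n m : ℕ} {φ : L.BoundedFormula α (m + 1)} (h : PrefixClass false (n + 1) φ) :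
      PrefixClass false (n + 1) φ.all
  | allSwitch {n m : ℕ} {φ : L.BoundedFormula α (m + 1)} (h : PrefixClass true n φ) :
      PrefixClass false (n + 1) φ.all

/-- `Σ_n` sentences. -/
def IsSigma {L : FirstOrder.Language.{0, 0}} (n : ℕ) (φ : L.Sentence) : Prop := PrefixClass true n φ

/-- `Π_n` sentences. -/
def IsPi {L : FirstOrder.Language.{0, 0}} (n : ℕ) (φ : L.Sentence) : Prop := PrefixClass false n φ

/-- The class of finite models of `φ` is closed under extensions. -/
def ExtensionClosed {L : FirstOrder.Language.{0, 0}} (φ : L.Sentence) : Prop :=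
  ∀ (A B : Type) [L.Structure A] [L.Structure B] [Finite A] [Finite B],
    (A ↪[L] B) → A ⊨ φ → B ⊨ φ

/-- `φ` and `ψ` are equivalent on the finite models of `χ`. -/
def EquivFiniteOn {L : FirstOrder.Language.{0, 0}} (χ φ ψ : L.Sentence) : Prop :=
  ∀ (A : Type) [L.Structure A] [Finite A], A ⊨ χ → (A ⊨ φ ↔ A ⊨ ψ)

/-- `φ` and `ψ` are equivalent in the finite. -/
def EquivFinite {L : FirstOrder.Language.{0, 0}} (φ ψ : L.Sentence) : Prop :=
  ∀ (A : Type) [L.Structure A] [Finite A], A ⊨ φ ↔ A ⊨ ψ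

/-! ### The vocabularies -/

/-- The relation symbols of the vocabulary `σ_n`: binary `≤`, binary `S_i, R_i` for `1 ≤ i ≤ n`
(with `S_1 = S`, `R_1 = R`), and unary `P_i` for `2 ≤ i ≤ n`. -/
inductive SigRel (n : ℕ) : ℕ → Type
  | le : SigRel n 2
  | S (i : ℕ) (h₁ : 1 ≤ i) (h₂ : i ≤ n) : SigRel n 2
  | R (i : ℕ) (h₁ : 1 ≤ i) (h₂ : i ≤ n) : SigRel n 2
  | P (i : ℕ) (h₁ : 2 ≤ i) (h₂ : i ≤ n) : SigRel n 1

/-- The vocabulary `σ_n`. -/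
def Sig (n : ℕ) : FirstOrder.Language.{0, 0} := ⟨fun _ => Empty, SigRel n⟩

/-- The inclusion of `σ_n` in `σ_{n+1}`. -/
def sigIncl (n : ℕ) : Sig n →ᴸ Sig (n + 1) where
  onFunction := fun _ f => f
  onRelation := fun _ r => match r with
    | SigRel.le => SigRel.le
    | SigRel.S i h₁ h₂ => SigRel.S i h₁ (Nat.le_succ_of_le h₂)
    | SigRel.R i h₁ h₂ => SigRel.R i h₁ (Nat.le_succ_of_le h₂)
    | SigRel.P i h₁ h₂ => SigRel.P i h₁ (Nat.le_succ_of_le h₂)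

/-- The relation symbols as symbols of the vocabulary `σ_n`. -/
def leSym (n : ℕ) : (Sig n).Relations 2 := SigRel.le
def SSym (n : ℕ) (h : 1 ≤ n) : (Sig n).Relations 2 := SigRel.S n h le_rfl
def RSym (n : ℕ) (h : 1 ≤ n) : (Sig n).Relations 2 := SigRel.R n h le_rfl
def PSym (n : ℕ) (h : 2 ≤ n) : (Sig n).Relations 1 := SigRel.P n h le_rfl

section Formulas

variable {n : ℕ} {α : Type} {m : ℕ}

/-- `s ≤ t`. -/
def leF (s t : (Sig n).Term (α ⊕ Fin m)) : (Sig n).BoundedFormula α m :=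
  (leSym n).boundedFormula₂ s t

/-- `s < t`, i.e. `s ≤ t ∧ s ≠ t`. -/
def ltF (s t : (Sig n).Term (α ⊕ Fin m)) : (Sig n).BoundedFormula α m :=
  leF s t ⊓ ∼(s =' t)

end Formulas

/-- The free variable `x` of a formula in the two free variables `x`, `y`. -/
def vx {n m : ℕ} : (Sig n).Term (Fin 2 ⊕ Fin m) := Term.var (Sum.inl 0)

/-- The free variable `y` of a formula in the two free variables `x`, `y`. -/
def vy {n m : ℕ} : (Sig n).Term (Fin 2 ⊕ Fin m) := Term.var (Sum.inl 1)

/-- For a formula `θ(x, y)`, the formula `θ(z, w)` where `z`, `w` are the two outermost quantified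
variables. -/
def atBound {n : ℕ} (α : Type) (θ : (Sig n).Formula (Fin 2)) : (Sig n).BoundedFormula α 2 :=
  BoundedFormula.relabel (Sum.inr : Fin 2 → α ⊕ Fin 2) θ

/-! ### Relativization to an interval -/

/-- `θ⋆`: every quantifier is relativized to the interval `[x, y]`. -/
def relativize {n : ℕ} : ∀ {m : ℕ},
    (Sig n).BoundedFormula (Fin 2) m → (Sig n).BoundedFormula (Fin 2) m
  | _, .falsum => .falsum
  | _, .equal s t => .equal s t
  | _, .rel r ts => .rel r ts
  | _, .imp θ₁ θ₂ => .imp (relativize θ₁) (relativize θ₂)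
  | m, .all θ => .all ((leF vx (Term.var (Sum.inr (Fin.last m))) ⊓
      leF (Term.var (Sum.inr (Fin.last m))) vy) ⟹ relativize θ)

/-- `θ^{[x, y]}`, for a sentence `θ`, is `x ≤ y ∧ θ⋆`. -/
def onInterval {n : ℕ} (θ : (Sig n).Sentence) : (Sig n).Formula (Fin 2) :=
  leF vx vy ⊓ relativize (Formula.relabel (Empty.elim : Empty → Fin 2) θ)

/-! ### The sentences -/

/-- `≤` is a linear order. -/
def linOrd (n : ℕ) : (Sig n).Sentence :=
  (leSym n).reflexive ⊓ (leSym n).antisymmetric ⊓ (leSym n).transitive ⊓ (leSym n).total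

/-- `NLO`: `≤` is not a linear order. -/
def NLO (n : ℕ) : (Sig n).Sentence := ∼(linOrd n)

/-- `PartialSucc`: `∀ x y, S(x, y) →` "`y` is the successor of `x`". -/
def partialSuccOne : (Sig 1).Sentence :=
  ∀' ∀' ((SSym 1 le_rfl).boundedFormula₂ (&0) (&1) ⟹
    (ltF (&0) (&1) ⊓ ∀' (leF (&2) (&0) ⊔ leF (&1) (&2))))

/-- `Total(x, y)`: `x < y ∧ ∀ z (x ≤ z ∧ z < y → ∃ w (z < w ∧ w ≤ y ∧ S(z, w)))`. -/
def totalOne : (Sig 1).Formula (Fin 2) :=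
  ltF vx vy ⊓
    ∀' ((leF vx (&0) ⊓ ltF (&0) vy) ⟹
      ∃' (ltF (&0) (&1) ⊓ leF (&1) vy ⊓ (SSym 1 le_rfl).boundedFormula₂ (&0) (&1)))

/-- `Succ_n(x, y)`, for `n ≥ 2`, built from the sentence `θ = SomeTotalR_{n-1}` (as a sentence over
`σ_n`): `P_n(x) ∧ P_n(y) ∧ S_n(x, y) ∧ θ^{[x, y]}`. -/
def succOf (n : ℕ) (h : 2 ≤ n) (θ : (Sig n).Sentence) : (Sig n).Formula (Fin 2) :=
  (PSym n h).boundedFormula₁ vx ⊓ (PSym n h).boundedFormula₁ vy ⊓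
    (SSym n (Nat.le_of_succ_le h)).boundedFormula₂ vx vy ⊓ onInterval θ

/-- `PartialSucc_n`, for `n ≥ 2`, built from `succ = Succ_n`:
`∀ x y (Succ_n(x, y) → ∀ z (P_n(z) → z ≤ x ∨ y ≤ z))`. -/
def partialSuccOf (n : ℕ) (h : 2 ≤ n) (succ : (Sig n).Formula (Fin 2)) : (Sig n).Sentence :=
  ∀' ∀' (atBound Empty succ ⟹
    ∀' ((PSym n h).boundedFormula₁ (&2) ⟹ (leF (&2) (&0) ⊔ leF (&1) (&2))))

/-- `Total_n(x, y)`, for `n ≥ 2`, built from `succ = Succ_n`: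
`P_n(x) ∧ x < y ∧ ∀ z (P_n(z) ∧ x ≤ z ∧ z < y → ∃ w (z < w ∧ w ≤ y ∧ Succ_n(z, w)))`.
The conjunct `P_n(x)` says that the chain of `Succ_n`-steps starts in `x`. -/
def totalOf (n : ℕ) (h : 2 ≤ n) (succ : (Sig n).Formula (Fin 2)) : (Sig n).Formula (Fin 2) :=
  (PSym n h).boundedFormula₁ vx ⊓ ltF vx vy ⊓
    ∀' (((PSym n h).boundedFormula₁ (&0) ⊓ leF vx (&0) ⊓ ltF (&0) vy) ⟹
      ∃' (ltF (&0) (&1) ⊓ leF (&1) vy ⊓ atBound (Fin 2) succ))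

/-- `R_n(x, y) ∧ total(x, y)`. -/
def RTotalOf (n : ℕ) (h : 1 ≤ n) (total : (Sig n).Formula (Fin 2)) : (Sig n).Formula (Fin 2) :=
  (RSym n h).boundedFormula₂ vx vy ⊓ total

/-- `¬ partialSucc ∨ ∃ x ∃ y, rTotal(x, y)`. -/
def someTotalROf {n : ℕ} (partialSucc : (Sig n).Sentence) (rTotal : (Sig n).Formula (Fin 2)) :
    (Sig n).Sentence :=
  ∼partialSucc ⊔ ∃' ∃' (atBound Empty rTotal)

/-- The pair of `PartialSucc_n` and `R_n(x, y) ∧ Total_n(x, y)`, by recursion on `n ≥ 1` (the value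
at `n = 0` is irrelevant). -/
def parts : (n : ℕ) → (Sig n).Sentence × (Sig n).Formula (Fin 2)
  | 0 => (⊥, ⊥)
  | 1 => (partialSuccOne, RTotalOf 1 le_rfl totalOne)
  | n + 2 =>
    let someTotalRPrev : (Sig (n + 1)).Sentence :=
      someTotalROf (parts (n + 1)).1 (parts (n + 1)).2
    let succ : (Sig (n + 2)).Formula (Fin 2) :=
      succOf (n + 2) (Nat.le_add_left 2 n) ((sigIncl (n + 1)).onSentence someTotalRPrev)
    (partialSuccOf (n + 2) (Nat.le_add_left 2 n) succ,
      RTotalOf (n + 2) (Nat.le_add_left 1 (n + 1))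
        (totalOf (n + 2) (Nat.le_add_left 2 n) succ))

/-- `PartialSucc_n`. -/
def partialSucc (n : ℕ) : (Sig n).Sentence := (parts n).1

/-- `R_n(x, y) ∧ Total_n(x, y)`. -/
def rTotal (n : ℕ) : (Sig n).Formula (Fin 2) := (parts n).2

/-- `SomeTotalR_n := ¬ PartialSucc_n ∨ ∃ x ∃ y (R_n(x, y) ∧ Total_n(x, y))`. -/
def someTotalR (n : ℕ) : (Sig n).Sentence := someTotalROf (partialSucc n) (rTotal n)

/-- `Succ_{n+1}`, for `n ≥ 1`, in terms of `SomeTotalR_n`. -/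
def succF (n : ℕ) (hn : 1 ≤ n) : (Sig (n + 1)).Formula (Fin 2) :=
  succOf (n + 1) (Nat.succ_le_succ hn) ((sigIncl n).onSentence (someTotalR n))

theorem partialSucc_one : partialSucc 1 = partialSuccOne := rfl

theorem rTotal_one : rTotal 1 = RTotalOf 1 le_rfl totalOne := rfl

theorem partialSucc_succ : ∀ (n : ℕ) (hn : 1 ≤ n), partialSucc (n + 1) =
    partialSuccOf (n + 1) (Nat.succ_le_succ hn) (succF n hn)
  | _ + 1, _ => rfl

theorem rTotal_succ : ∀ (n : ℕ) (hn : 1 ≤ n), rTotal (n + 1) =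
    RTotalOf (n + 1) (Nat.le_add_left 1 n)
      (totalOf (n + 1) (Nat.succ_le_succ hn) (succF n hn))
  | _ + 1, _ => rfl

/-- The vocabulary `σ_n` with two new constants `a` (index `0`) and `b` (index `1`). -/
abbrev SigC (n : ℕ) : FirstOrder.Language.{0, 0} := (Sig n)[[Fin 2]]

/-- The sentence `φ_n := NLO ∨ ¬ PartialSucc_n ∨ (R_n(a, b) ∧ Total_n(a, b))`, obtained from
`NLO ∨ SomeTotalR_n` by removing the two outer existential quantifiers and replacing the resulting
free variables by the constants `a` and `b`. -/
def phi (n : ℕ) : (SigC n).Sentence :=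
  ((Sig n).lhomWithConstants (Fin 2)).onSentence (NLO n) ⊔
    (((Sig n).lhomWithConstants (Fin 2)).onSentence (∼(partialSucc n)) ⊔
      Formula.equivSentence (rTotal n))

/-- `≤` is a linear order with minimum `a` and maximum `b`. -/
def orderedMinMax (n : ℕ) : (SigC n).Sentence :=
  ((Sig n).lhomWithConstants (Fin 2)).onSentence (linOrd n) ⊓
    Formula.equivSentence (∀' (leF vx (&0) ⊓ leF (&0) vy) : (Sig n).Formula (Fin 2))

end ExtPres

/-!
The sentence `φ_n` is put into prenex form, shown to be preserved under extensions of finite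
structures, and separated from every `Σ_{2n}` sentence by a game argument on finite words. Levels
are counted from `0` below, so `i` stands for the index `i + 1` of the vocabulary, and `n = i + 1`.

*Meaning and prefix.* The relativized sentences speak about substructures on intervals. In a linear
order, `Succ_{i+1}(x, y)` depends only on the interval `[x, y]` (`Rels.LocalEmb.suc_iff`), so the
nested relativizations collapse and the sentences have the expected recursive meaning
(`realize_parts`, `realize_phi`). This meaning no longer mentions relativization, and it makes
`Succ_{i+1}` a `Σ_{2i+1}` relation and `Total_{i+1}` a `Π_{2i+2}` relation (`sucDef`, `defBy_phi`).

*Extensions.* By induction on the level, `Succ_{i+1}` is preserved under linearly ordered extensions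
(`Rels.Emb.suc`). If the extension also satisfies `PartialSucc_{i+1}`, then no new point of the
level lies between the ends of a preserved step. A finite chain of steps therefore stays a complete
chain (`Rels.Emb.tot`); finiteness provides the last step that starts below a given point.

*Lower bound.* For finite ordered structures with constants for their endpoints, let `X ≤_m Y` mean
that `Σ_m` sentences with blocks of at most `k` quantifiers pass from `X` to `Y`; this
follows from a game with `m` rounds (`Word.Leq`, `Word.exists_le_imp_realize`). Gluing the maximum
of one structure to the minimum of the next makes these structures a monoid, and `≤_m` is compatible
with products (`Word.Leq.mul`). As there are finitely many types, some power `V` of `Y` satisfies `V * V ≤ V`.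
This gives the pumping lemma `Word.Le.pump`: if `X ≤_m Y`, then a long power of `Y` is `≤_{m+1}` a
product `Y ^ (t + 1) * X * Y ^ (u + 1)`. Indeed, the first block of moves misses the interior of
some factor of a long product; that factor can be replaced by `X`, and idempotency adjusts what lies
on its two sides.

Pumping is applied twice at each level. Suppose `X ≤_{2i+1} Y`, and `Total_{i+1}` holds
between the endpoints of `Y` but not between those of `X`. Then it holds between the endpoints of a
power of `Y`, and fails for a product with a factor `X`; with `R_{i+1}` added between the endpoints these are words
`A ≤_{2i+2} B` that `φ_{i+1}` distinguishes (`Word.PlainPair.mainPair`). Conversely, a power of `B`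
contains no total `R_{i+1}`-interval, while a product of copies of `B` and one `A` contains one, so
that `SomeTotalR_{i+1}` distinguishes them in the other direction at `≤_{2i+3}`. Marking their
endpoints by `P_{i+2}` and joining these by `S_{i+2}` makes them the `X` and `Y` of the next level
(`Word.MainPair.plainPair`).
-/

namespace ExtPres

/-! ### The properties of the sentences, level by level -/

/-- The relations of a `σ_n`-structure on `M`, for all `n` at once: `bin true i` and `bin false i`
stand for `S_{i+1}` and `R_{i+1}`, and `P i` for `P_{i+1}`. -/
structure Rels (M : Type) where
  le : M → M → Prop
  bin : Bool → ℕ → M → M → Prop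
  P : ℕ → M → Prop

namespace Rels

variable {M N : Type}

/-- The strict order. -/
def lt (D : Rels M) (x y : M) : Prop := D.le x y ∧ x ≠ y

/-- The interval `[x, y]`. -/
def Icc (D : Rels M) (x y : M) : Set M := {z | D.le x z ∧ D.le z y}

/-- The points that matter at level `i`: all of them at the lowest level, which has no unary
predicate. -/
def Pt (D : Rels M) (i : ℕ) (x : M) : Prop := i = 0 ∨ D.P i x

/-- The property `PartialSucc_{i+1}` of the substructure on `U`, where `suc` interprets
`Succ_{i+1}`. -/
def PSOf (D : Rels M) (i : ℕ) (suc : M → M → Prop) (U : Set M) : Prop :=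
  ∀ x ∈ U, ∀ y ∈ U, suc x y →
    (i = 0 → D.lt x y) ∧ ∀ z ∈ U, D.Pt i z → D.le z x ∨ D.le y z

/-- The property `Total_{i+1}(x, y)`, where `suc` interprets `Succ_{i+1}`. -/
def TotOf (D : Rels M) (i : ℕ) (suc : M → M → Prop) (x y : M) : Prop :=
  D.Pt i x ∧ D.lt x y ∧ ∀ z, D.Pt i z → D.le x z → D.lt z y →
    ∃ w, D.lt z w ∧ D.le w y ∧ suc z w

/-- The property `SomeTotalR_{i+1}` of the substructure on `U`, for convex `U`, where `suc`
interprets `Succ_{i+1}`. -/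
def STROf (D : Rels M) (i : ℕ) (suc : M → M → Prop) (U : Set M) : Prop :=
  ¬ D.PSOf i suc U ∨ ∃ x ∈ U, ∃ y ∈ U, D.bin false i x y ∧ D.TotOf i suc x y

/-- The relation `Succ_{i+1}`; at the lowest level it is `S_1`. -/
def suc (D : Rels M) : ℕ → M → M → Prop
  | 0 => D.bin true 0
  | i + 1 => fun x y => D.P (i + 1) x ∧ D.P (i + 1) y ∧ D.bin true (i + 1) x y ∧
      D.le x y ∧ D.STROf i (D.suc i) (D.Icc x y)

/-- `PartialSucc_{i+1}` on `U`. -/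
abbrev PS (D : Rels M) (i : ℕ) (U : Set M) : Prop := D.PSOf i (D.suc i) U

/-- `Total_{i+1}(x, y)`. -/
abbrev Tot (D : Rels M) (i : ℕ) (x y : M) : Prop := D.TotOf i (D.suc i) x y

/-- `SomeTotalR_{i+1}` on `U`. -/
abbrev STR (D : Rels M) (i : ℕ) (U : Set M) : Prop := D.STROf i (D.suc i) U

theorem suc.bin {D : Rels M} {i : ℕ} {x y : M} (h : D.suc i x y) : D.bin true i x y := by
  cases i with
  | zero => exact h
  | succ i => exact h.2.2.1

theorem suc.pt {D : Rels M} {i : ℕ} {x y : M} (h : D.suc i x y) : D.Pt i y := by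
  cases i with
  | zero => exact Or.inl rfl
  | succ i => exact Or.inr h.2.1

/-! ### Locality -/

/-- On the convex set `U`, `f` is an isomorphism of orders, and its image is convex. -/
structure LocalEmb (D : Rels N) (E : Rels M) (U : Set N) (f : N → M) : Prop where
  convex : ∀ x ∈ U, ∀ y ∈ U, ∀ z, D.le x z → D.le z y → z ∈ U
  le_iff : ∀ x ∈ U, ∀ y ∈ U, (E.le (f x) (f y) ↔ D.le x y)
  inj : Set.InjOn f U
  surj : ∀ x ∈ U, ∀ y ∈ U, ∀ w, E.le (f x) w → E.le w (f y) → ∃ z ∈ U, f z = w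

section LocalEmb

variable {D : Rels N} {E : Rels M} {U : Set N} {f : N → M}

theorem LocalEmb.lt_iff (h : LocalEmb D E U f) {x y : N} (hx : x ∈ U) (hy : y ∈ U) :
    E.lt (f x) (f y) ↔ D.lt x y := by
  unfold lt
  rw [h.le_iff x hx y hy, Ne, h.inj.eq_iff hx hy]

theorem LocalEmb.image_Icc (h : LocalEmb D E U f) {x y : N} (hx : x ∈ U) (hy : y ∈ U) :
    f '' D.Icc x y = E.Icc (f x) (f y) := by
  ext w
  constructor
  · rintro ⟨z, ⟨h1, h2⟩, rfl⟩
    have hz := h.convex x hx y hy z h1 h2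
    exact ⟨(h.le_iff x hx z hz).2 h1, (h.le_iff z hz y hy).2 h2⟩
  · rintro ⟨h1, h2⟩
    obtain ⟨z, hz, rfl⟩ := h.surj x hx y hy w h1 h2
    exact ⟨z, ⟨(h.le_iff x hx z hz).1 h1, (h.le_iff z hz y hy).1 h2⟩, rfl⟩

variable {i : ℕ} {r : N → N → Prop} {s : M → M → Prop}

theorem LocalEmb.PSOf_iff (h : LocalEmb D E U f)
    (hP : ∀ x ∈ U, (E.P i (f x) ↔ D.P i x)) (hs : ∀ x ∈ U, ∀ y ∈ U, (s (f x) (f y) ↔ r x y))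
    {V : Set N} (hV : V ⊆ U) : E.PSOf i s (f '' V) ↔ D.PSOf i r V := by
  simp only [PSOf, Set.forall_mem_image, Pt]
  refine forall₂_congr fun x hx => forall₂_congr fun y hy => ?_
  rw [hs x (hV hx) y (hV hy), h.lt_iff (hV hx) (hV hy)]
  refine imp_congr_right fun _ => and_congr_right fun _ => forall₂_congr fun z hz => ?_
  rw [hP z (hV hz), h.le_iff z (hV hz) x (hV hx), h.le_iff y (hV hy) z (hV hz)]

theorem LocalEmb.TotOf_iff (h : LocalEmb D E U f)
    (hP : ∀ x ∈ U, (E.P i (f x) ↔ D.P i x)) (hs : ∀ x ∈ U, ∀ y ∈ U, (s (f x) (f y) ↔ r x y))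
    {x y : N} (hx : x ∈ U) (hy : y ∈ U) : E.TotOf i s (f x) (f y) ↔ D.TotOf i r x y := by
  unfold TotOf Pt
  rw [hP x hx, h.lt_iff hx hy]
  refine and_congr_right fun _ => and_congr_right fun _ => ⟨fun H z h1 h2 h3 => ?_,
    fun H z h1 h2 h3 => ?_⟩
  · have hz := h.convex x hx y hy z h2 h3.1
    obtain ⟨w, h4, h5, h6⟩ := H (f z) (by rwa [hP z hz]) ((h.le_iff x hx z hz).2 h2)
      ((h.lt_iff hz hy).2 h3)
    obtain ⟨w, hw, rfl⟩ := h.surj z hz y hy w h4.1 h5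
    exact ⟨w, (h.lt_iff hz hw).1 h4, (h.le_iff w hw y hy).1 h5, (hs z hz w hw).1 h6⟩
  · obtain ⟨z, hz, rfl⟩ := h.surj x hx y hy z h2 h3.1
    obtain ⟨w, h4, h5, h6⟩ := H z (by rwa [hP z hz] at h1) ((h.le_iff x hx z hz).1 h2)
      ((h.lt_iff hz hy).1 h3)
    have hw := h.convex z hz y hy w h4.1 h5
    exact ⟨f w, (h.lt_iff hz hw).2 h4, (h.le_iff w hw y hy).2 h5, (hs z hz w hw).2 h6⟩

theorem LocalEmb.STROf_iff (h : LocalEmb D E U f) (hP : ∀ x ∈ U, (E.P i (f x) ↔ D.P i x))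
    (hR : ∀ x ∈ U, ∀ y ∈ U, (E.bin false i (f x) (f y) ↔ D.bin false i x y))
    (hs : ∀ x ∈ U, ∀ y ∈ U, (s (f x) (f y) ↔ r x y)) {V : Set N} (hV : V ⊆ U) :
    E.STROf i s (f '' V) ↔ D.STROf i r V := by
  unfold STROf
  rw [h.PSOf_iff hP hs hV]
  simp only [Set.exists_mem_image]
  refine or_congr_right (exists_congr fun x => and_congr_right fun hx =>
    exists_congr fun y => and_congr_right fun hy => ?_)
  rw [hR x (hV hx) y (hV hy), h.TotOf_iff hP hs (hV hx) (hV hy)]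

/-- `Succ_{i+1}(x, y)` depends only on the isomorphism type of the interval `[x, y]`. -/
theorem LocalEmb.suc_iff (h : LocalEmb D E U f) (i : ℕ)
    (hP : ∀ j ≤ i, ∀ x ∈ U, (E.P j (f x) ↔ D.P j x))
    (hS : ∀ j ≤ i, ∀ x ∈ U, ∀ y ∈ U, (E.bin true j (f x) (f y) ↔ D.bin true j x y))
    (hR : ∀ j < i, ∀ x ∈ U, ∀ y ∈ U, (E.bin false j (f x) (f y) ↔ D.bin false j x y)) :
    ∀ x ∈ U, ∀ y ∈ U, (E.suc i (f x) (f y) ↔ D.suc i x y) := by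
  induction i with
  | zero => exact hS 0 le_rfl
  | succ i ih =>
    intro x hx y hy
    have ih := ih (fun j hj => hP j (by omega)) (fun j hj => hS j (by omega))
      (fun j hj => hR j (by omega))
    simp only [suc]
    rw [hP _ le_rfl x hx, hP _ le_rfl y hy, hS _ le_rfl x hx y hy, h.le_iff x hx y hy,
      ← h.image_Icc hx hy, h.STROf_iff (hP i (by omega)) (hR i (by omega)) ih
        fun z hz => h.convex x hx y hy z hz.1 hz.2]

end LocalEmb

/-! ### Preservation under extensions -/

/-- `≤` is a linear order. -/
structure Lin (D : Rels M) : Prop where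
  refl : ∀ x, D.le x x
  antisymm : ∀ x y, D.le x y → D.le y x → x = y
  trans : ∀ x y z, D.le x y → D.le y z → D.le x z
  total : ∀ x y, D.le x y ∨ D.le y x

/-- `f` is an embedding of the relations `D` into the relations `E`. -/
structure Emb (D : Rels N) (E : Rels M) (f : N → M) : Prop where
  inj : Function.Injective f
  le_iff : ∀ x y, E.le (f x) (f y) ↔ D.le x y
  bin_iff : ∀ b i x y, E.bin b i (f x) (f y) ↔ D.bin b i x y
  P_iff : ∀ i x, E.P i (f x) ↔ D.P i x

section Emb

variable {D : Rels N} {E : Rels M} {f : N → M}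

theorem Emb.lt_iff (h : Emb D E f) (x y : N) : E.lt (f x) (f y) ↔ D.lt x y := by
  unfold lt
  rw [h.le_iff, Ne, h.inj.eq_iff]

theorem Lin.comap (hE : E.Lin) (hf : Function.Injective f)
    (h : ∀ x y, E.le (f x) (f y) ↔ D.le x y) : D.Lin where
  refl _ := (h _ _).1 (hE.refl _)
  antisymm _ _ h1 h2 := hf (hE.antisymm _ _ ((h _ _).2 h1) ((h _ _).2 h2))
  trans _ _ _ h1 h2 := (h _ _).1 (hE.trans _ _ _ ((h _ _).2 h1) ((h _ _).2 h2))
  total x y := (hE.total (f x) (f y)).imp (h _ _).1 (h _ _).1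

theorem Emb.lin (h : Emb D E f) (hE : E.Lin) : D.Lin := hE.comap h.inj h.le_iff

theorem Emb.PS_of_PS (h : Emb D E f) {i : ℕ}
    (hs : ∀ x y, D.suc i x y → E.suc i (f x) (f y)) {U : Set N} {V : Set M}
    (hUV : ∀ x ∈ U, f x ∈ V) (H : E.PS i V) : D.PS i U := by
  intro x hx y hy hxy
  obtain ⟨h1, h2⟩ := H (f x) (hUV x hx) (f y) (hUV y hy) (hs x y hxy)
  refine ⟨fun h0 => (h.lt_iff x y).1 (h1 h0), fun z hz hPz => ?_⟩
  refine (h2 (f z) (hUV z hz) ?_).imp (h.le_iff _ _).1 (h.le_iff _ _).1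
  exact hPz.imp id (h.P_iff i z).2

/-- A finite chain of successor steps stays total in a linearly ordered extension in which these
steps are still successor steps. -/
theorem Emb.tot [Finite N] (h : Emb D E f) (hE : E.Lin) {i : ℕ}
    (hs : ∀ x y, D.suc i x y → E.suc i (f x) (f y)) {V : Set M} (H : E.PS i V) {x y : N}
    (hV : ∀ z, E.le (f x) z → E.le z (f y) → z ∈ V) (hT : D.Tot i x y) :
    E.Tot i (f x) (f y) := by
  obtain ⟨hx, hxy, hT⟩ := hT
  have hD := h.lin hE
  refine ⟨hx.imp id (h.P_iff i x).2, (h.lt_iff x y).2 hxy, fun z hz hxz hzy => ?_⟩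
  -- the last step of the chain that starts below `z`
  obtain ⟨u, ⟨hu1, hu2, hu3, hu4⟩, hmax⟩ : ∃ u, (D.Pt i u ∧ D.le x u ∧ D.lt u y ∧ E.le (f u) z) ∧
      ∀ w, (D.Pt i w ∧ D.le x w ∧ D.lt w y ∧ E.le (f w) z) → ¬ D.lt u w := by
    have : IsTrans N (fun u w => D.lt w u) := ⟨fun a b c hab hbc =>
      ⟨hD.trans _ _ _ hbc.1 hab.1, fun hac => hab.2 (hD.antisymm _ _ hab.1 (hac ▸ hbc.1))⟩⟩
    have : Std.Irrefl (fun u w => D.lt w u) := ⟨fun a ha => ha.2 rfl⟩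
    obtain ⟨u, hu, hmin⟩ := (Finite.wellFounded_of_trans_of_irrefl (fun u w => D.lt w u)).has_min
      {u | D.Pt i u ∧ D.le x u ∧ D.lt u y ∧ E.le (f u) z} ⟨x, hx, hD.refl x, hxy, hxz⟩
    exact ⟨u, hu, fun w hw => hmin w hw⟩
  obtain ⟨w, huw, hwy, hsuc⟩ := hT u hu1 hu2 hu3
  have hxw := hD.trans _ _ _ hu2 huw.1
  have hfu : f u ∈ V := hV _ ((h.le_iff _ _).2 hu2) ((h.le_iff _ _).2 hu3.1)
  have hfw : f w ∈ V := hV _ ((h.le_iff _ _).2 hxw) ((h.le_iff _ _).2 hwy)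
  rcases (H _ hfu _ hfw (hs _ _ hsuc)).2 z (hV z hxz hzy.1) hz with h1 | h1
  · obtain rfl := hE.antisymm _ _ h1 hu4
    exact ⟨f w, (h.lt_iff _ _).2 huw, (h.le_iff _ _).2 hwy, hs _ _ hsuc⟩
  · refine absurd huw (hmax w ⟨hsuc.pt, hxw, ⟨hwy, ?_⟩, h1⟩)
    rintro rfl
    exact hzy.2 (hE.antisymm _ _ hzy.1 h1)

theorem Emb.str [Finite N] (h : Emb D E f) (hE : E.Lin) {i : ℕ}
    (hs : ∀ x y, D.suc i x y → E.suc i (f x) (f y)) {U : Set N} {V : Set M}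
    (hUV : ∀ x ∈ U, f x ∈ V) (hV : ∀ x ∈ V, ∀ y ∈ V, ∀ z, E.le x z → E.le z y → z ∈ V)
    (hT : D.STR i U) : E.STR i V := by
  by_cases H : E.PS i V
  · rcases hT with hT | ⟨x, hx, y, hy, hR, hT⟩
    · exact absurd (h.PS_of_PS hs hUV H) hT
    · exact Or.inr ⟨f x, hUV x hx, f y, hUV y hy, (h.bin_iff _ _ _ _).2 hR,
        h.tot hE hs H (hV _ (hUV x hx) _ (hUV y hy)) hT⟩
  · exact Or.inl H

/-- `Succ_{i+1}` is preserved under linearly ordered extensions of finite structures. -/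
theorem Emb.suc [Finite N] (h : Emb D E f) (hE : E.Lin) (i : ℕ) (x y : N) (hxy : D.suc i x y) :
    E.suc i (f x) (f y) := by
  induction i generalizing x y with
  | zero => exact (h.bin_iff _ _ _ _).2 hxy
  | succ i ih =>
    obtain ⟨h1, h2, h3, h4, h5⟩ := hxy
    refine ⟨(h.P_iff _ _).2 h1, (h.P_iff _ _).2 h2, (h.bin_iff _ _ _ _).2 h3,
      (h.le_iff _ _).2 h4, h.str hE ih (fun z hz => ?_) (fun u hu v hv z h6 h7 => ?_) h5⟩
    · exact ⟨(h.le_iff _ _).2 hz.1, (h.le_iff _ _).2 hz.2⟩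
    · exact ⟨hE.trans _ _ _ hu.1 h6, hE.trans _ _ _ h7 hv.2⟩

end Emb

/-- The property `φ_{i+1}` of the relations `D` with constants `a`, `b`. -/
def Phi (D : Rels M) (i : ℕ) (a b : M) : Prop :=
  ¬ D.Lin ∨ ¬ D.PS i Set.univ ∨ (D.bin false i a b ∧ D.Tot i a b)

theorem Emb.phi {D : Rels N} {E : Rels M} {f : N → M} [Finite N] (h : Emb D E f) {i : ℕ} {a b : N}
    (H : D.Phi i a b) : E.Phi i (f a) (f b) := by
  by_cases hE : E.Lin
  · by_cases hP : E.PS i Set.univ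
    · rcases H with H | H | ⟨hR, hT⟩
      · exact absurd (h.lin hE) H
      · exact absurd (h.PS_of_PS (h.suc hE i) (fun _ _ => Set.mem_univ _) hP) H
      · exact Or.inr (Or.inr ⟨(h.bin_iff _ _ _ _).2 hR,
          h.tot hE (h.suc hE i) hP (fun _ _ _ => Set.mem_univ _) hT⟩)
    · exact Or.inr (Or.inl hP)
  · exact Or.inl hE

end Rels

/-! ### The meaning of the sentences -/

/-- The relations of a `σ_n`-structure. Those of the levels not in `σ_n` are empty. -/
def toRels (n : ℕ) (M : Type) [(Sig n).Structure M] : Rels M where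
  le x y := Structure.RelMap (leSym n) ![x, y]
  bin b i x y := ∃ h : i + 1 ≤ n, Structure.RelMap (L := Sig n)
    (if b then SigRel.S (i + 1) i.succ_pos h else SigRel.R (i + 1) i.succ_pos h) ![x, y]
  P i x := ∃ (h₁ : 2 ≤ i + 1) (h : i + 1 ≤ n),
    Structure.RelMap (L := Sig n) (SigRel.P (i + 1) h₁ h) ![x]

section Realize

variable {n : ℕ} {M : Type} [(Sig n).Structure M] {α : Type} {m : ℕ} {v : α → M} {xs : Fin m → M}

theorem realize_leF (s t : (Sig n).Term (α ⊕ Fin m)) : (leF s t).Realize v xs ↔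
    (toRels n M).le (s.realize (Sum.elim v xs)) (t.realize (Sum.elim v xs)) :=
  BoundedFormula.realize_rel₂

theorem realize_ltF (s t : (Sig n).Term (α ⊕ Fin m)) : (ltF s t).Realize v xs ↔
    (toRels n M).lt (s.realize (Sum.elim v xs)) (t.realize (Sum.elim v xs)) := by
  simp [ltF, realize_leF, Rels.lt]

theorem realize_S (h : 1 ≤ n) (s t : (Sig n).Term (α ⊕ Fin m)) :
    ((SSym n h).boundedFormula₂ s t).Realize v xs ↔ (toRels n M).bin true (n - 1)
      (s.realize (Sum.elim v xs)) (t.realize (Sum.elim v xs)) := by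
  obtain ⟨n, rfl⟩ : ∃ k, n = k + 1 := ⟨n - 1, by omega⟩
  rw [BoundedFormula.realize_rel₂]
  exact ⟨fun H => ⟨le_rfl, H⟩, fun ⟨_, H⟩ => H⟩

theorem realize_R (h : 1 ≤ n) (s t : (Sig n).Term (α ⊕ Fin m)) :
    ((RSym n h).boundedFormula₂ s t).Realize v xs ↔ (toRels n M).bin false (n - 1)
      (s.realize (Sum.elim v xs)) (t.realize (Sum.elim v xs)) := by
  obtain ⟨n, rfl⟩ : ∃ k, n = k + 1 := ⟨n - 1, by omega⟩
  rw [BoundedFormula.realize_rel₂]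
  exact ⟨fun H => ⟨le_rfl, H⟩, fun ⟨_, H⟩ => H⟩

theorem realize_P (h : 2 ≤ n) (s : (Sig n).Term (α ⊕ Fin m)) :
    ((PSym n h).boundedFormula₁ s).Realize v xs ↔ (toRels n M).P (n - 1)
      (s.realize (Sum.elim v xs)) := by
  obtain ⟨n, rfl⟩ : ∃ k, n = k + 1 := ⟨n - 1, by omega⟩
  rw [BoundedFormula.realize_rel₁]
  exact ⟨fun H => ⟨h, le_rfl, H⟩, fun ⟨_, _, H⟩ => H⟩

theorem realize_linOrd : M ⊨ linOrd n ↔ (toRels n M).Lin := by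
  simp only [linOrd, Sentence.Realize, Formula.Realize, BoundedFormula.realize_inf]
  have h1 := Relations.realize_reflexive (M := M) (r := leSym n)
  have h2 := Relations.realize_antisymmetric (M := M) (r := leSym n)
  have h3 := Relations.realize_transitive (M := M) (r := leSym n)
  have h4 := Relations.realize_total (M := M) (r := leSym n)
  simp only [Sentence.Realize, Formula.Realize] at h1 h2 h3 h4
  rw [h1, h2, h3, h4]
  constructor
  · rintro ⟨⟨⟨h1, h2⟩, h3⟩, h4⟩
    exact ⟨h1.refl, fun x y => h2.antisymm x y, fun x y z => h3.trans x y z, h4.total⟩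
  · rintro ⟨h1, h2, h3, h4⟩
    exact ⟨⟨⟨⟨h1⟩, ⟨h2⟩⟩, ⟨h3⟩⟩, ⟨h4⟩⟩

theorem realize_atBound (θ : (Sig n).Formula (Fin 2)) (ys : Fin 2 → M) :
    (atBound α θ).Realize v ys ↔ θ.Realize ys := by
  unfold atBound
  rw [BoundedFormula.realize_relabel]
  simp [Formula.Realize, Unique.eq_default]

end Realize

/-! ### Relativization -/

/-- The structure on the subset `U` is the one induced by `M`. -/
def IsInduced (n : ℕ) {M : Type} [(Sig n).Structure M] (U : Set M) [(Sig n).Structure U] : Prop :=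
  ∀ {k : ℕ} (r : (Sig n).Relations k) (xs : Fin k → U),
    Structure.RelMap r xs ↔ Structure.RelMap r (fun i => (xs i : M))

/-- A relativized formula holds of elements of an interval if and only if the formula itself holds
of them in the substructure on the interval. -/
theorem realize_relativize {n : ℕ} {M : Type} [(Sig n).Structure M] (x y : M)
    (U : Set M) [(Sig n).Structure U] (hind : IsInduced n U) (hU : U = (toRels n M).Icc x y)
    (v : Fin 2 → U) (hx : v 0 = x) (hy : v 1 = y)
    {m : ℕ} (θ : (Sig n).BoundedFormula (Fin 2) m) (xs : Fin m → U) :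
    (relativize θ).Realize (fun i => (v i : M)) (fun i => (xs i : M)) ↔ θ.Realize v xs := by
  have ht : ∀ {m : ℕ} (t : (Sig n).Term (Fin 2 ⊕ Fin m)) (xs : Fin m → U),
      t.realize (Sum.elim (fun i => (v i : M)) (fun i => (xs i : M))) =
        ((t.realize (Sum.elim v xs) : U) : M) := by
    intro m t xs
    cases t with
    | var a => rcases a with a | a <;> rfl
    | func f _ => exact Empty.elim f
  induction θ with
  | falsum => exact Iff.rfl
  | equal s t => simp [relativize, BoundedFormula.Realize, ht, Subtype.ext_iff]
  | rel r ts => simp [relativize, BoundedFormula.Realize, ht, hind r]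
  | imp θ₁ θ₂ ih₁ ih₂ => simp [relativize, BoundedFormula.Realize, ih₁, ih₂]
  | all θ ih =>
    simp only [relativize, BoundedFormula.Realize, BoundedFormula.realize_inf, realize_leF]
    have key : ∀ z : U, (fun i => ((Fin.snoc (α := fun _ => U) xs z i : U) : M)) =
        Fin.snoc (α := fun _ => M) (fun i => (xs i : M)) (z : M) := by
      intro z
      funext i
      refine Fin.lastCases ?_ (fun i => ?_) i <;> simp
    constructor
    · intro H z
      have hz : (z : M) ∈ (toRels n M).Icc x y := hU ▸ z.2
      refine (ih _).1 ?_
      rw [key]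
      refine H z ?_
      simp only [vx, vy, Term.realize_var, Sum.elim_inl, Sum.elim_inr, Fin.snoc_last, hx, hy]
      exact hz
    · intro H z hz
      simp only [vx, vy, Term.realize_var, Sum.elim_inl, Sum.elim_inr, Fin.snoc_last, hx, hy] at hz
      have hz' : z ∈ U := by rw [hU]; exact hz
      have := (ih _).2 (H ⟨z, hz'⟩)
      rwa [key] at this

theorem realize_onInterval {n : ℕ} {M : Type} [(Sig n).Structure M] (hM : (toRels n M).Lin)
    (θ : (Sig n).Sentence) (v : Fin 2 → M)
    [(Sig n).Structure ((toRels n M).Icc (v 0) (v 1))]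
    (hind : IsInduced n ((toRels n M).Icc (v 0) (v 1))) :
    (onInterval θ).Realize v ↔ (toRels n M).le (v 0) (v 1) ∧
      (toRels n M).Icc (v 0) (v 1) ⊨ θ := by
  unfold onInterval Formula.Realize
  rw [BoundedFormula.realize_inf, realize_leF]
  refine and_congr_right fun hxy => ?_
  have h := realize_relativize (v 0) (v 1) _ hind rfl
    ![⟨v 0, hM.refl _, hxy⟩, ⟨v 1, hxy, hM.refl _⟩] rfl rfl
    (Formula.relabel (Empty.elim : Empty → Fin 2) θ) default
  have hv : (fun i => ((![⟨v 0, hM.refl _, hxy⟩, ⟨v 1, hxy, hM.refl _⟩] :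
      Fin 2 → (toRels n M).Icc (v 0) (v 1)) i : M)) = v := by
    funext i
    fin_cases i <;> rfl
  rw [hv, Unique.eq_default (fun i : Fin 0 => _)] at h
  rw [h]
  exact (Formula.realize_relabel).trans (by rw [Unique.eq_default (_ ∘ _)]; rfl)

/-! ### The recursion -/

theorem realize_someTotalROf {n : ℕ} {M : Type} [(Sig n).Structure M] (p : (Sig n).Sentence)
    (t : (Sig n).Formula (Fin 2)) : M ⊨ someTotalROf p t ↔
      ¬ M ⊨ p ∨ ∃ x y : M, t.Realize ![x, y] := by
  simp only [someTotalROf, Sentence.Realize, Formula.Realize, BoundedFormula.realize_sup,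
    BoundedFormula.realize_not, BoundedFormula.realize_ex, realize_atBound]
  refine or_congr_right (exists_congr fun x => exists_congr fun y => ?_)
  rw [show Fin.snoc (Fin.snoc default x) y = ![x, y] by
    funext i; fin_cases i <;> rfl]

/-- In linear orders the sentences have the meaning given by the recursion for `Rels`. In the step,
the substructure on an interval is reduced to the smaller vocabulary, where the induction hypothesis
applies, and `Succ` is moved back to the whole structure by locality. -/
theorem realize_parts (n : ℕ) : ∀ (M : Type) [(Sig (n + 1)).Structure M],
    (toRels (n + 1) M).Lin →
    (M ⊨ partialSucc (n + 1) ↔ (toRels (n + 1) M).PS n Set.univ) ∧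
    ∀ v : Fin 2 → M, (rTotal (n + 1)).Realize v ↔
      (toRels (n + 1) M).bin false n (v 0) (v 1) ∧ (toRels (n + 1) M).Tot n (v 0) (v 1) := by
  induction n with
  | zero =>
    intro M _ hM
    constructor
    · simp [-BoundedFormula.realize_rel₂, partialSucc_one, partialSuccOne, Sentence.Realize,
        Formula.Realize, realize_S, realize_ltF, realize_leF, Rels.PSOf, Rels.suc, Rels.Pt, Fin.snoc]
    · intro v
      simp [-BoundedFormula.realize_rel₂, rTotal_one, RTotalOf, totalOne, Formula.Realize,
        realize_R, realize_S, realize_ltF, realize_leF, Rels.TotOf, Rels.suc, Rels.Pt, Fin.snoc, vx, vy, and_assoc]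
  | succ n ih =>
    intro M _ hM
    have hsuc : ∀ v : Fin 2 → M, (succF (n + 1) n.succ_pos).Realize v ↔
        (toRels (n + 2) M).suc (n + 1) (v 0) (v 1) := by
      intro v
      set U := (toRels (n + 2) M).Icc (v 0) (v 1) with hU
      -- the substructure on the interval, and its reduct to the smaller vocabulary
      let _ : (Sig (n + 2)).Structure U :=
        { funMap := fun f _ => Empty.elim f
          RelMap := fun r xs => Structure.RelMap r (fun i => (xs i : M)) }
      let _ : (Sig (n + 1)).Structure U := (sigIncl (n + 1)).reduct U
      have hind : IsInduced (n + 2) U := fun r xs => Iff.rfl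
      simp only [succF, succOf, Formula.Realize, BoundedFormula.realize_inf, realize_P, realize_S]
      rw [← Formula.Realize, realize_onInterval hM _ _ hind]
      simp only [vx, vy, Term.realize_var, Sum.elim_inl, Rels.suc, and_assoc]
      refine and_congr_right fun _ => and_congr_right fun _ => and_congr_right fun _ =>
        and_congr_right fun hxy => ?_
      rw [LHom.realize_onSentence, someTotalR, realize_someTotalROf]
      have h₂ : ∀ a b : U, (fun i => ((![a, b] i : U) : M)) = ![(a : M), (b : M)] := by
        intro a b; funext i; fin_cases i <;> rfl
      have h₁ : ∀ a : U, (fun i => ((![a] i : U) : M)) = ![(a : M)] := by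
        intro a; funext i; fin_cases i; rfl
      have hle : ∀ a b : U, (toRels (n + 2) M).le (a : M) b ↔ (toRels (n + 1) U).le a b := by
        intro a b
        simp only [toRels]
        rw [← h₂]
        rfl
      have hloc : Rels.LocalEmb (toRels (n + 1) U) (toRels (n + 2) M) Set.univ
          (Subtype.val : U → M) :=
        ⟨fun _ _ _ _ _ _ _ => trivial, fun a _ b _ => hle a b, Subtype.val_injective.injOn,
          fun a _ b _ w h1 h2 => ⟨⟨w, hM.trans _ _ _ a.2.1 h1, hM.trans _ _ _ h2 b.2.2⟩,
            trivial, rfl⟩⟩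
      have hP : ∀ j ≤ n, ∀ a ∈ Set.univ, ((toRels (n + 2) M).P j (a : U) ↔
          (toRels (n + 1) U).P j a) := by
        intro j hj a _
        simp only [toRels]
        rw [← h₁]
        have h' : j + 1 ≤ n + 1 := by omega
        exact ⟨fun ⟨h, _, H⟩ => ⟨h, h', H⟩, fun ⟨h, _, H⟩ => ⟨h, h'.trans (Nat.le_succ _), H⟩⟩
      have hB : ∀ b, ∀ j ≤ n, ∀ a ∈ Set.univ, ∀ c ∈ Set.univ,
          ((toRels (n + 2) M).bin b j (a : U) (c : U) ↔ (toRels (n + 1) U).bin b j a c) := by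
        intro b j hj a _ c _
        simp only [toRels]
        rw [← h₂]
        have h' : j + 1 ≤ n + 1 := by omega
        cases b
        · exact ⟨fun ⟨_, H⟩ => ⟨h', H⟩, fun ⟨_, H⟩ => ⟨h'.trans (Nat.le_succ _), H⟩⟩
        · exact ⟨fun ⟨_, H⟩ => ⟨h', H⟩, fun ⟨_, H⟩ => ⟨h'.trans (Nat.le_succ _), H⟩⟩
      have hUlin : (toRels (n + 1) U).Lin :=
        Rels.Lin.comap hM Subtype.val_injective hle
      have hs := hloc.suc_iff n hP (hB true) fun j hj => hB false j hj.le
      have h := hloc.STROf_iff (hP n le_rfl) (hB false n le_rfl) hs subset_rfl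
      rw [Set.image_univ, Subtype.range_val] at h
      rw [h, (ih U hUlin).1]
      simp only [(ih U hUlin).2, Rels.STROf, Set.mem_univ, true_and]
      rfl
    have hsuc' : ∀ a b : M, BoundedFormula.Realize (succF (n + 1) n.succ_pos)
        (Fin.snoc (α := fun _ => M) (Fin.snoc (α := fun _ => M) default a) b) default ↔
          (toRels (n + 2) M).suc (n + 1) a b :=
      fun a b => hsuc (Fin.snoc (α := fun _ => M) (Fin.snoc (α := fun _ => M) default a) b)
    constructor
    · rw [partialSucc_succ (n + 1) n.succ_pos]
      simp [-BoundedFormula.realize_rel₂, -BoundedFormula.realize_rel₁, partialSuccOf,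
        Sentence.Realize, Formula.Realize, realize_P, realize_atBound, hsuc', realize_leF,
        Rels.PSOf, Rels.Pt, Fin.snoc]
    · intro v
      rw [rTotal_succ (n + 1) n.succ_pos]
      simp [-BoundedFormula.realize_rel₂, -BoundedFormula.realize_rel₁, RTotalOf, totalOf,
        Formula.Realize, realize_R, realize_P, realize_atBound, hsuc', realize_leF, realize_ltF,
        Rels.TotOf, Rels.Pt, Fin.snoc, vx, vy, and_assoc]

/-- The element named by a constant symbol. -/
def endpt (n : ℕ) (M : Type) [(SigC n).Structure M] (i : Fin 2) : M :=
  (((Sig n).con i : (SigC n).Constants) : M)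

/-- The relations of a structure with two constants. -/
def toRelsC (n : ℕ) (M : Type) [(SigC n).Structure M] : Rels M :=
  letI := ((Sig n).lhomWithConstants (Fin 2)).reduct M
  toRels n M

theorem realize_phi {n : ℕ} {M : Type} [(SigC (n + 1)).Structure M] :
    M ⊨ phi (n + 1) ↔ (toRelsC (n + 1) M).Phi n (endpt (n + 1) M 0) (endpt (n + 1) M 1) := by
  let _ : (Sig (n + 1)).Structure M := ((Sig (n + 1)).lhomWithConstants (Fin 2)).reduct M
  change _ ↔ (toRels (n + 1) M).Phi n _ _
  have h1 : M ⊨ phi (n + 1) ↔ (M ⊨ NLO (n + 1) ∨ (M ⊨ ∼(partialSucc (n + 1)) ∨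
      (rTotal (n + 1)).Realize (endpt (n + 1) M))) := by
    simp only [phi, Sentence.Realize, Formula.Realize, BoundedFormula.realize_sup]
    refine or_congr ?_ (or_congr ?_ ?_)
    · exact LHom.realize_onSentence M ((Sig (n + 1)).lhomWithConstants (Fin 2)) (NLO (n + 1))
    · exact LHom.realize_onSentence M ((Sig (n + 1)).lhomWithConstants (Fin 2))
        (∼(partialSucc (n + 1)) : (Sig (n + 1)).Sentence)
    · exact Formula.realize_equivSentence M (rTotal (n + 1))
  rw [h1, NLO, Sentence.realize_not, Sentence.realize_not, realize_linOrd, Rels.Phi]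
  by_cases hM : (toRels (n + 1) M).Lin
  · rw [(realize_parts n M hM).1, (realize_parts n M hM).2]
  · simp [hM]

theorem realize_orderedMinMax {n : ℕ} {M : Type} [(SigC n).Structure M] :
    M ⊨ orderedMinMax n ↔ (toRelsC n M).Lin ∧
      ∀ x, (toRelsC n M).le (endpt n M 0) x ∧ (toRelsC n M).le x (endpt n M 1) := by
  let _ : (Sig n).Structure M := ((Sig n).lhomWithConstants (Fin 2)).reduct M
  change _ ↔ (toRels n M).Lin ∧ ∀ x, (toRels n M).le (endpt n M 0) x ∧
    (toRels n M).le x (endpt n M 1)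
  have h1 : M ⊨ orderedMinMax n ↔ (M ⊨ linOrd n ∧
      Formula.Realize (∀' (leF vx (&0) ⊓ leF (&0) vy) : (Sig n).Formula (Fin 2))
        (endpt n M)) := by
    simp only [orderedMinMax, Sentence.Realize, Formula.Realize, BoundedFormula.realize_inf]
    refine and_congr ?_ ?_
    · exact LHom.realize_onSentence M ((Sig n).lhomWithConstants (Fin 2)) (linOrd n)
    · exact Formula.realize_equivSentence M
        (∀' (leF vx (&0) ⊓ leF (&0) vy) : (Sig n).Formula (Fin 2))
  rw [h1, realize_linOrd]
  refine and_congr_right fun _ => ?_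
  simp [Formula.Realize, realize_leF, vx, vy, Fin.snoc]

/-! ### Closure properties of the prefix classes -/

section Prefix

variable {L : FirstOrder.Language.{0, 0}} {α : Type} {m : ℕ}

/-- The existential quantifier for `b = true` and the universal one for `b = false`. -/
def quant (b : Bool) (φ : L.BoundedFormula α (m + 1)) : L.BoundedFormula α m :=
  bif b then φ.ex else φ.all

theorem PrefixClass.same {b : Bool} {k : ℕ} {φ : L.BoundedFormula α (m + 1)}
    (h : PrefixClass b (k + 1) φ) : PrefixClass b (k + 1) (quant b φ) := by
  cases b
  · exact h.all
  · exact h.ex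

theorem PrefixClass.switch {b : Bool} {k : ℕ} {φ : L.BoundedFormula α (m + 1)}
    (h : PrefixClass (!b) k φ) : PrefixClass b (k + 1) (quant b φ) := by
  cases b
  · exact h.allSwitch
  · exact h.exSwitch

/-- Induction on the quantifier prefix that treats both quantifiers at once. -/
theorem PrefixClass.quantInduction
    {motive : ∀ {b : Bool} {k m : ℕ} {φ : L.BoundedFormula α m}, PrefixClass b k φ → Prop}
    (qf : ∀ {b : Bool} {k m : ℕ} {φ : L.BoundedFormula α m} (h : φ.IsQF),
      motive (.qf h : PrefixClass b k φ))
    (same : ∀ {b : Bool} {k m : ℕ} {φ : L.BoundedFormula α (m + 1)}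
      (h : PrefixClass b (k + 1) φ), motive h → motive h.same)
    (switch : ∀ {b : Bool} {k m : ℕ} {φ : L.BoundedFormula α (m + 1)}
      (h : PrefixClass (!b) k φ), motive h → motive h.switch)
    {b : Bool} {k m : ℕ} {φ : L.BoundedFormula α m} (h : PrefixClass b k φ) : motive h := by
  induction h with
  | qf h => exact qf h
  | ex h ih => exact same (b := true) h ih
  | exSwitch h ih => exact switch (b := true) h ih
  | all h ih => exact same (b := false) h ih
  | allSwitch h ih => exact switch (b := false) h ih

theorem PrefixClass.castLE {b : Bool} {k m m' : ℕ} {φ : L.BoundedFormula α m} (h : m ≤ m')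
    (hφ : PrefixClass b k φ) : PrefixClass b k (φ.castLE h) := by
  induction hφ generalizing m' with
  | qf hq => exact .qf (hq.castLE)
  | ex _ ih => exact .ex (ih _)
  | exSwitch _ ih => exact .exSwitch (ih _)
  | all _ ih => exact .all (ih _)
  | allSwitch _ ih => exact .allSwitch (ih _)

theorem PrefixClass.liftAt {b : Bool} {k m j l : ℕ} {φ : L.BoundedFormula α m}
    (hφ : PrefixClass b k φ) : PrefixClass b k (φ.liftAt j l) := by
  induction hφ with
  | qf hq => exact .qf hq.liftAt
  | ex _ ih => exact .ex (ih.castLE _)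
  | exSwitch _ ih => exact .exSwitch (ih.castLE _)
  | all _ ih => exact .all (ih.castLE _)
  | allSwitch _ ih => exact .allSwitch (ih.castLE _)

theorem PrefixClass.succ {b : Bool} {k : ℕ} {φ : L.BoundedFormula α m}
    (hφ : PrefixClass b k φ) : PrefixClass b (k + 1) φ := by
  induction hφ with
  | qf hq => exact .qf hq
  | ex _ ih => exact .ex ih
  | exSwitch _ ih => exact .exSwitch ih
  | all _ ih => exact .all ih
  | allSwitch _ ih => exact .allSwitch ih

/-- Logical equivalence over nonempty structures. -/
def Equivalent (φ ψ : L.BoundedFormula α m) : Prop :=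
  ∀ (M : Type) [L.Structure M] [Nonempty M] (v : α → M) (xs : Fin m → M),
    φ.Realize v xs ↔ ψ.Realize v xs

theorem PrefixClass.exists_not {b : Bool} {k : ℕ} {φ : L.BoundedFormula α m}
    (hφ : PrefixClass b k φ) :
    ∃ χ : L.BoundedFormula α m, PrefixClass (!b) k χ ∧ Equivalent χ (∼φ) := by
  induction hφ using PrefixClass.quantInduction with
  | qf hq => exact ⟨_, .qf hq.not, fun _ _ _ _ _ => Iff.rfl⟩
  | @same b k m φ h ih =>
    obtain ⟨χ, h1, h2⟩ := ih
    refine ⟨_, h1.same, fun M _ _ v xs => ?_⟩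
    cases b <;> simp [quant, h2 M]
  | @switch b k m φ h ih =>
    obtain ⟨χ, h1, h2⟩ := ih
    refine ⟨_, h1.switch, fun M _ _ v xs => ?_⟩
    cases b <;> simp [quant, h2 M]

/-- Conjunctions of formulas of the class `b k` are, up to equivalence, in the class. -/
def ClosedInf (L : FirstOrder.Language.{0, 0}) (α : Type) (b : Bool) (k : ℕ) : Prop :=
  ∀ {m : ℕ} {φ ψ : L.BoundedFormula α m}, PrefixClass b k φ → PrefixClass b k ψ →
    ∃ χ : L.BoundedFormula α m, PrefixClass b k χ ∧ Equivalent χ (φ ⊓ ψ)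

theorem Equivalent.quant_inf {b : Bool} {φ χ : L.BoundedFormula α (m + 1)}
    {ψ : L.BoundedFormula α m} (h : Equivalent χ (φ ⊓ ψ.liftAt 1 m)) :
    Equivalent (quant b χ) (quant b φ ⊓ ψ) := by
  intro M _ _ v xs
  cases b <;> simp [quant, h M, BoundedFormula.realize_liftAt_one_self, forall_and]

theorem Equivalent.inf_comm {χ φ ψ : L.BoundedFormula α m} (h : Equivalent χ (φ ⊓ ψ)) :
    Equivalent χ (ψ ⊓ φ) := by
  intro M _ _ v xs
  rw [h M, BoundedFormula.realize_inf, BoundedFormula.realize_inf, and_comm]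

/-- The quantifiers of `ψ` are pulled out one by one until only a block of the other kind is left,
where the conjunction with `φ` stays within the class. -/
theorem PrefixClass.exists_inf_switch {b : Bool} {j : ℕ} {ψ : L.BoundedFormula α m}
    (hψ : PrefixClass b j ψ) : ∀ k, j = k + 1 → ClosedInf L α (!b) k →
    ∀ φ : L.BoundedFormula α m, PrefixClass (!b) k φ →
      ∃ χ : L.BoundedFormula α m, PrefixClass b (k + 1) χ ∧ Equivalent χ (φ ⊓ ψ) := by
  induction hψ using PrefixClass.quantInduction with
  | @qf b _ m ψ hq =>
    intro k _ hC φ hφ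
    obtain ⟨χ, h1, h2⟩ := hC hφ (.qf hq)
    -- a dummy quantifier
    refine ⟨quant b (χ.liftAt 1 m), h1.liftAt.switch, fun M _ _ v xs => ?_⟩
    cases b <;> simp [quant, h2 M, BoundedFormula.realize_liftAt_one_self]
  | @same b j m ψ h ih =>
    intro k hk hC φ hφ
    obtain ⟨χ, h1, h2⟩ := ih k hk hC (φ.liftAt 1 m) hφ.liftAt
    exact ⟨_, h1.same, h2.inf_comm.quant_inf.inf_comm⟩
  | @switch b j m ψ h ih =>
    intro k hk hC φ hφ
    obtain rfl : j = k := by omega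
    obtain ⟨χ, h1, h2⟩ := hC hφ.liftAt h
    exact ⟨_, h1.switch, h2.inf_comm.quant_inf.inf_comm⟩

/-- The leading block of `φ` is pulled out before the leading block of `ψ`, so that the two blocks
merge into one. -/
theorem PrefixClass.exists_inf_of_closedInf {b : Bool} {j : ℕ} {φ : L.BoundedFormula α m}
    (hφ : PrefixClass b j φ) : ∀ k, j = k + 1 → ClosedInf L α (!b) k →
    ∀ ψ : L.BoundedFormula α m, PrefixClass b (k + 1) ψ →
      ∃ χ : L.BoundedFormula α m, PrefixClass b (k + 1) χ ∧ Equivalent χ (φ ⊓ ψ) := by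
  induction hφ using PrefixClass.quantInduction with
  | qf hq => exact fun k _ hC ψ hψ => hψ.exists_inf_switch k rfl hC _ (.qf hq)
  | @same b j m φ h ih =>
    intro k hk hC ψ hψ
    obtain ⟨χ, h1, h2⟩ := ih k hk hC (ψ.liftAt 1 m) hψ.liftAt
    exact ⟨_, h1.same, h2.quant_inf⟩
  | @switch b j m φ h ih =>
    intro k hk hC ψ hψ
    obtain rfl : j = k := by omega
    obtain ⟨χ, h1, h2⟩ := (hψ.liftAt (j := 1) (l := m)).exists_inf_switch _ rfl hC _ h
    exact ⟨_, h1.same, h2.quant_inf⟩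

theorem closedInf (b : Bool) (k : ℕ) : ClosedInf L α b k := by
  induction k generalizing b with
  | zero =>
    have hqf : ∀ {m : ℕ} {φ : L.BoundedFormula α m}, PrefixClass b 0 φ → φ.IsQF := by
      intro m φ h
      cases h with
      | qf h => exact h
    exact fun {_ _ _} h1 h2 => ⟨_, .qf ((hqf h1).inf (hqf h2)), fun _ _ _ _ _ => Iff.rfl⟩
  | succ k ih => exact fun {_ _ _} h1 h2 => h1.exists_inf_of_closedInf k rfl (ih _) _ h2

/-! ### Definable predicates -/

/-- A predicate on `m`-tuples of elements of structures. -/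
abbrev Pred (L : FirstOrder.Language.{0, 0}) (m : ℕ) : Type 1 :=
  ∀ (M : Type) [L.Structure M], (Fin m → M) → Prop

/-- The predicate is defined, in nonempty structures, by a formula of the prefix class `b k`. -/
def DefBy (b : Bool) (k : ℕ) (Q : Pred L m) : Prop :=
  ∃ ψ : L.BoundedFormula Empty m, PrefixClass b k ψ ∧
    ∀ (M : Type) [L.Structure M] [Nonempty M] (v : Empty → M) (xs : Fin m → M),
      ψ.Realize v xs ↔ Q M xs

variable {b : Bool} {k : ℕ} {Q Q' : Pred L m}

theorem DefBy.not (h : DefBy b k Q) : DefBy (!b) k (fun M _ xs => ¬ Q M xs : Pred L m) := by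
  obtain ⟨ψ, h1, h2⟩ := h
  obtain ⟨χ, h3, h4⟩ := h1.exists_not
  exact ⟨χ, h3, fun M _ _ v xs => by rw [h4 M, BoundedFormula.realize_not, h2]⟩

theorem DefBy.and (h : DefBy b k Q) (h' : DefBy b k Q') :
    DefBy b k (fun M _ xs => Q M xs ∧ Q' M xs : Pred L m) := by
  obtain ⟨ψ, h1, h2⟩ := h
  obtain ⟨ψ', h1', h2'⟩ := h'
  obtain ⟨χ, h3, h4⟩ := closedInf b k h1 h1'
  exact ⟨χ, h3, fun M _ _ v xs => by rw [h4 M, BoundedFormula.realize_inf, h2, h2']⟩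

theorem DefBy.congr (h : DefBy b k Q)
    (H : ∀ (M : Type) [L.Structure M] (xs : Fin m → M), Q M xs ↔ Q' M xs) : DefBy b k Q' := by
  obtain ⟨ψ, h1, h2⟩ := h
  exact ⟨ψ, h1, fun M _ _ v xs => (h2 M v xs).trans (H M xs)⟩

theorem DefBy.neg {b' : Bool} (h : DefBy b' k Q) (hb : b' = !b := by rfl) :
    DefBy b k (fun M _ xs => ¬ Q M xs : Pred L m) := by
  subst hb
  simpa using h.not

theorem DefBy.or (h : DefBy b k Q) (h' : DefBy b k Q') :
    DefBy b k (fun M _ xs => Q M xs ∨ Q' M xs : Pred L m) :=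
  (h.not.and h'.not).neg.congr fun M _ xs => by tauto

theorem DefBy.imp {b' : Bool} (h : DefBy b' k Q) (h' : DefBy b k Q') (hb : b' = !b := by rfl) :
    DefBy b k (fun M _ xs => Q M xs → Q' M xs : Pred L m) :=
  ((h.neg hb).or h').congr fun M _ xs => by tauto

theorem DefBy.succ (h : DefBy b k Q) : DefBy b (k + 1) Q := by
  obtain ⟨ψ, h1, h2⟩ := h
  exact ⟨ψ, h1.succ, h2⟩

theorem DefBy.switch {b' : Bool} (h : DefBy b' k Q) (hb : b' = !b := by rfl) :
    DefBy b (k + 1) Q := by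
  subst hb
  obtain ⟨ψ, h1, h2⟩ := h
  refine ⟨quant b (ψ.liftAt 1 m), h1.liftAt.switch, fun M _ _ v xs => ?_⟩
  rw [← h2 M v xs]
  cases b <;> simp [quant, BoundedFormula.realize_liftAt_one_self]

variable {Q₁ : Pred L (m + 1)}

theorem DefBy.ex (h : DefBy true (k + 1) Q₁) :
    DefBy true (k + 1) (fun M _ xs => ∃ x, Q₁ M (Fin.snoc xs x) : Pred L m) := by
  obtain ⟨ψ, h1, h2⟩ := h
  exact ⟨ψ.ex, h1.ex, fun M _ _ v xs => by simp [h2]⟩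

theorem DefBy.all (h : DefBy false (k + 1) Q₁) :
    DefBy false (k + 1) (fun M _ xs => ∀ x, Q₁ M (Fin.snoc xs x) : Pred L m) := by
  obtain ⟨ψ, h1, h2⟩ := h
  exact ⟨ψ.all, h1.all, fun M _ _ v xs => by simp [h2]⟩

end Prefix

/-! ### The prefix class of the sentences -/

/-- The atomic terms over `m` bound variables: the variables and the two constants. -/
abbrev Pnt (m : ℕ) : Type := Fin m ⊕ Fin 2

namespace Pnt

variable {m : ℕ}

/-- The value of an atomic term. -/
def ev (n : ℕ) (s : Pnt m) (M : Type) [(SigC n).Structure M] (xs : Fin m → M) : M :=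
  Sum.elim xs (endpt n M) s

/-- The same term, under one more quantifier. -/
def up (s : Pnt m) : Pnt (m + 1) := Sum.map Fin.castSucc id s

/-- The innermost variable. -/
def top (m : ℕ) : Pnt (m + 1) := Sum.inl (Fin.last m)

/-- The atomic term as a term. -/
def toTerm (n : ℕ) (s : Pnt m) : (SigC n).Term (Empty ⊕ Fin m) :=
  Sum.elim (fun i => Term.var (Sum.inr i)) (fun i => ((Sig n).con i).term) s

variable {n : ℕ} {M : Type} [(SigC n).Structure M]

@[simp] theorem ev_up (s : Pnt m) (xs : Fin m → M) (x : M) :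
    s.up.ev n M (Fin.snoc xs x) = s.ev n M xs := by
  cases s <;> simp [up, ev]

@[simp] theorem ev_top (xs : Fin m → M) (x : M) : (top m).ev n M (Fin.snoc xs x) = x := by
  simp [top, ev]

theorem realize_toTerm (s : Pnt m) (v : Empty → M) (xs : Fin m → M) :
    (s.toTerm n).realize (Sum.elim v xs) = s.ev n M xs := by
  cases s with
  | inl i => rfl
  | inr i => simp [toTerm, ev, endpt]

end Pnt

section Atoms

variable {n m : ℕ} {b : Bool} {k : ℕ}

theorem DefBy.rel₂ (r : (SigC n).Relations 2) (s t : Pnt m) :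
    DefBy (L := SigC n) b k (fun M _ xs =>
      Structure.RelMap r
        ![s.ev n M xs, t.ev n M xs]) :=
  ⟨r.boundedFormula₂ (s.toTerm n) (t.toTerm n),
    .qf (.of_isAtomic (.rel _ _)), fun M _ _ v xs => by
      rw [BoundedFormula.realize_rel₂, Pnt.realize_toTerm, Pnt.realize_toTerm]⟩

theorem DefBy.rel₁ (r : (SigC n).Relations 1) (s : Pnt m) :
    DefBy (L := SigC n) b k (fun M _ xs =>
      Structure.RelMap r ![s.ev n M xs]) :=
  ⟨r.boundedFormula₁ (s.toTerm n),
    .qf (.of_isAtomic (.rel _ _)), fun M _ _ v xs => by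
      rw [BoundedFormula.realize_rel₁, Pnt.realize_toTerm]⟩

theorem DefBy.const (p : Prop) :
    DefBy (L := SigC n) b k (fun _ _ _ => p : Pred (SigC n) m) := by
  by_cases hp : p
  · exact ⟨⊤, .qf .top, fun M _ _ v xs => by simp [hp]⟩
  · exact ⟨⊥, .qf .falsum, fun M _ _ v xs => by simp [hp]⟩

theorem DefBy.le (s t : Pnt m) :
    DefBy (L := SigC n) b k (fun M _ xs => (toRelsC n M).le (s.ev n M xs) (t.ev n M xs)) :=
  DefBy.rel₂ (Sum.inl (leSym n)) s t

theorem DefBy.lt (s t : Pnt m) :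
    DefBy (L := SigC n) b k (fun M _ xs => (toRelsC n M).lt (s.ev n M xs) (t.ev n M xs)) := by
  refine (DefBy.le s t).and ⟨∼((s.toTerm n).bdEqual (t.toTerm n)),
    .qf (BoundedFormula.IsQF.of_isAtomic (.equal _ _)).not, fun M _ _ v xs => ?_⟩
  rw [BoundedFormula.realize_not, BoundedFormula.realize_bdEqual, Pnt.realize_toTerm,
    Pnt.realize_toTerm]

theorem DefBy.bin (c : Bool) (i : ℕ) (s t : Pnt m) :
    DefBy (L := SigC n) b k (fun M _ xs =>
      (toRelsC n M).bin c i (s.ev n M xs) (t.ev n M xs)) := by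
  by_cases h : i + 1 ≤ n
  · refine (DefBy.rel₂ (Sum.inl (if c then SigRel.S (i + 1) i.succ_pos h else
      SigRel.R (i + 1) i.succ_pos h : SigRel n 2)) s t).congr fun M _ xs => ?_
    exact ⟨fun H => ⟨h, H⟩, fun ⟨_, H⟩ => H⟩
  · exact (DefBy.const False).congr fun M _ xs => ⟨False.elim, fun ⟨h', _⟩ => h h'⟩

theorem DefBy.P (i : ℕ) (s : Pnt m) :
    DefBy (L := SigC n) b k (fun M _ xs => (toRelsC n M).P i (s.ev n M xs)) := by
  by_cases h : 2 ≤ i + 1 ∧ i + 1 ≤ n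
  · refine (DefBy.rel₁ (Sum.inl (SigRel.P (i + 1) h.1 h.2 : SigRel n 1)) s).congr fun M _ xs => ?_
    exact ⟨fun H => ⟨h.1, h.2, H⟩, fun ⟨_, _, H⟩ => H⟩
  · exact (DefBy.const False).congr fun M _ xs => ⟨False.elim, fun ⟨h₁, h₂, _⟩ => h ⟨h₁, h₂⟩⟩

theorem DefBy.pt (i : ℕ) (s : Pnt m) :
    DefBy (L := SigC n) b k (fun M _ xs => (toRelsC n M).Pt i (s.ev n M xs)) :=
  (DefBy.const (i = 0)).or (DefBy.P i s)

/-- The whole structure, or an interval. -/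
def dom (n : ℕ) : Option (Pnt m × Pnt m) → ∀ (M : Type) [(SigC n).Structure M],
    (Fin m → M) → Set M
  | none, _, _, _ => Set.univ
  | some (s, t), M, _, xs => (toRelsC n M).Icc (s.ev n M xs) (t.ev n M xs)

@[simp] theorem dom_up (c : Option (Pnt m × Pnt m)) {M : Type} [(SigC n).Structure M]
    (xs : Fin m → M) (x : M) :
    dom n (c.map (Prod.map Pnt.up Pnt.up)) M (Fin.snoc xs x) = dom n c M xs := by
  rcases c with _ | ⟨s, t⟩ <;> simp [dom]

theorem DefBy.mem_dom (c : Option (Pnt m × Pnt m)) (s : Pnt m) :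
    DefBy (L := SigC n) b k (fun M _ xs => s.ev n M xs ∈ dom n c M xs) := by
  rcases c with _ | ⟨u, v⟩
  · exact (DefBy.const True).congr fun M _ xs => by simp [dom]
  · exact (DefBy.le u s).and (DefBy.le s v)

end Atoms

section Levels

variable {n : ℕ}

/-- `Succ_{i+1}` is a `Σ_{2i+1}` relation. -/
def SucDef (n i : ℕ) : Prop := ∀ (m : ℕ) (s t : Pnt m), DefBy (L := SigC n) true (2 * i + 1)
  (fun M _ xs => (toRelsC n M).suc i (s.ev n M xs) (t.ev n M xs))

theorem SucDef.ps {i : ℕ} (h : SucDef n i) {m : ℕ} (c : Option (Pnt m × Pnt m)) :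
    DefBy (L := SigC n) false (2 * i + 1) (fun M _ xs => (toRelsC n M).PS i (dom n c M xs)) := by
  let u : ∀ {m}, Option (Pnt m × Pnt m) → Option (Pnt (m + 1) × Pnt (m + 1)) :=
    fun c => c.map (Prod.map Pnt.up Pnt.up)
  let x₁ := Pnt.top m
  let x₂ := x₁.up
  let x₃ := x₂.up
  let y₂ := Pnt.top (m + 1)
  let y₃ := y₂.up
  let z₃ := Pnt.top (m + 2)
  refine (DefBy.all ((DefBy.mem_dom (u c) x₁).imp (DefBy.all ((DefBy.mem_dom (u (u c)) y₂).imp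
    ((h _ x₂ y₂).imp (((DefBy.const (i = 0)).imp (DefBy.lt x₂ y₂)).and (DefBy.all
      ((DefBy.mem_dom (u (u (u c))) z₃).imp ((DefBy.pt i z₃).imp
        ((DefBy.le z₃ x₃).or (DefBy.le y₃ z₃))))))))))).congr fun M _ xs => ?_
  simp only [u, x₁, x₂, x₃, y₂, y₃, z₃, dom_up, Pnt.ev_up, Pnt.ev_top]
  rfl

theorem SucDef.tot {i : ℕ} (h : SucDef n i) {m : ℕ} (s t : Pnt m) :
    DefBy (L := SigC n) false (2 * i + 2)
      (fun M _ xs => (toRelsC n M).Tot i (s.ev n M xs) (t.ev n M xs)) := by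
  let z₁ := Pnt.top m
  let z₂ := z₁.up
  let w₂ := Pnt.top (m + 1)
  refine ((DefBy.pt i s).and ((DefBy.lt s t).and (DefBy.all ((DefBy.pt i z₁).imp
    ((DefBy.le s.up z₁).imp ((DefBy.lt z₁ t.up).imp (DefBy.ex ((DefBy.lt z₂ w₂).and
      ((DefBy.le w₂ t.up.up).and (h _ z₂ w₂)))).switch)))))).congr fun M _ xs => ?_
  simp only [z₁, z₂, w₂, Pnt.ev_up, Pnt.ev_top]
  rfl

theorem SucDef.str {i : ℕ} (h : SucDef n i) {m : ℕ} (c : Option (Pnt m × Pnt m)) :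
    DefBy (L := SigC n) true (2 * i + 3)
      (fun M _ xs => (toRelsC n M).STR i (dom n c M xs)) := by
  let u : ∀ {m}, Option (Pnt m × Pnt m) → Option (Pnt (m + 1) × Pnt (m + 1)) :=
    fun c => c.map (Prod.map Pnt.up Pnt.up)
  let x₁ := Pnt.top m
  let x₂ := x₁.up
  let y₂ := Pnt.top (m + 1)
  refine (DefBy.or (h.ps c).neg.succ.succ (DefBy.ex ((DefBy.mem_dom (u c) x₁).and (DefBy.ex
    ((DefBy.mem_dom (u (u c)) y₂).and ((DefBy.bin false i x₂ y₂).and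
      (h.tot x₂ y₂).switch)))))).congr fun M _ xs => ?_
  simp only [u, x₁, x₂, y₂, dom_up, Pnt.ev_up, Pnt.ev_top]
  rfl

theorem sucDef (n i : ℕ) : SucDef n i := by
  induction i with
  | zero => exact fun _ s t => DefBy.bin true 0 s t
  | succ i ih =>
    intro m s t
    exact (DefBy.P (i + 1) s).and ((DefBy.P (i + 1) t).and ((DefBy.bin true (i + 1) s t).and
      ((DefBy.le s t).and (ih.str (some (s, t))))))

theorem defBy_lin (n : ℕ) : DefBy (L := SigC n) (m := 0) false 1
    (fun M _ _ => (toRelsC n M).Lin) := by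
  let x₁ := Pnt.top 0
  let x₂ := x₁.up
  let x₃ := x₂.up
  let y₂ := Pnt.top 1
  let y₃ := y₂.up
  let z₃ := Pnt.top 2
  have h1 := DefBy.all (k := 0) (DefBy.le (n := n) x₁ x₁)
  have h2 := DefBy.all (k := 0) (DefBy.all ((DefBy.le (n := n) x₂ y₂).imp
    ((DefBy.le y₂ x₂).imp (DefBy.lt x₂ y₂).neg)))
  have h3 := DefBy.all (k := 0) (DefBy.all (DefBy.all ((DefBy.le (n := n) x₃ y₃).imp
    ((DefBy.le y₃ z₃).imp (DefBy.le x₃ z₃)))))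
  have h4 := DefBy.all (k := 0) (DefBy.all ((DefBy.le (n := n) x₂ y₂).or (DefBy.le y₂ x₂)))
  refine (h1.and (h2.and (h3.and h4))).congr fun M _ xs => ?_
  simp only [x₁, x₂, x₃, y₂, y₃, z₃, Pnt.ev_up, Pnt.ev_top]
  constructor
  · rintro ⟨h1, h2, h3, h4⟩
    exact ⟨h1, fun x y hx hy => not_not.1 fun hne => h2 x y hx hy ⟨hx, hne⟩, h3, h4⟩
  · rintro ⟨h1, h2, h3, h4⟩
    exact ⟨h1, fun x y hx hy hlt => hlt.2 (h2 x y hx hy), h3, h4⟩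

theorem defBy_phi (i : ℕ) : DefBy (L := SigC (i + 1)) (m := 0) false (2 * (i + 1))
    (fun M _ _ => (toRelsC (i + 1) M).Phi i (endpt (i + 1) M 0) (endpt (i + 1) M 1)) := by
  have hlin : DefBy (L := SigC (i + 1)) (m := 0) true (2 * i + 1)
      (fun M _ _ => ¬ (toRelsC (i + 1) M).Lin) := by
    refine DefBy.neg ?_
    induction 2 * i with
    | zero => exact defBy_lin _
    | succ k ih => exact ih.succ
  exact hlin.switch.or ((((sucDef (i + 1) i).ps none).neg (b := true)).switch.or
    ((DefBy.bin false i (Sum.inr 0) (Sum.inr 1)).and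
      ((sucDef (i + 1) i).tot (Sum.inr 0) (Sum.inr 1))))

end Levels

/-! ### Gluing finite ordered structures -/

/-- A finite structure with the universe `{0, …, len}` in its usual order. As in `Rels`,
`bin true i` and `bin false i` stand for `S_{i+1}` and `R_{i+1}`, and `P i` for `P_{i+1}`. -/
@[ext] structure Word where
  len : ℕ
  bin : Bool → ℕ → ℕ → ℕ → Prop
  P : ℕ → ℕ → Prop
  bin_lt : ∀ {b i x y}, bin b i x y → x < y
  bin_le : ∀ {b i x y}, bin b i x y → y ≤ len
  P_le : ∀ {i x}, P i x → x ≤ len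

namespace Word

/-- The relations of a word, on all natural numbers. -/
def rels (X : Word) : Rels ℕ := ⟨(· ≤ ·), X.bin, X.P⟩

/-- The product glues the last element of `X` to the first element of `Y`. -/
instance : Mul Word where
  mul X Y :=
    { len := X.len + Y.len
      bin := fun b i x y => X.bin b i x y ∨ (X.len ≤ x ∧ Y.bin b i (x - X.len) (y - X.len))
      P := fun i x => X.P i x ∨ (X.len ≤ x ∧ Y.P i (x - X.len))
      bin_lt := by
        rintro b i x y (h | ⟨_, h⟩)
        · exact X.bin_lt h
        · have := Y.bin_lt h
          omega
      bin_le := by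
        rintro b i x y (h | ⟨_, h⟩)
        · have := X.bin_le h
          omega
        · have := Y.bin_le h
          omega
      P_le := by
        rintro i x (h | ⟨_, h⟩)
        · have := X.P_le h
          omega
        · have := Y.P_le h
          omega }

instance : One Word where
  one := ⟨0, fun _ _ _ _ => False, fun _ _ => False, False.elim, False.elim, False.elim⟩

theorem len_mul (X Y : Word) : (X * Y).len = X.len + Y.len := rfl

theorem bin_mul (X Y : Word) (b : Bool) (i x y : ℕ) : (X * Y).bin b i x y ↔
    X.bin b i x y ∨ (X.len ≤ x ∧ Y.bin b i (x - X.len) (y - X.len)) := Iff.rfl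

theorem P_mul (X Y : Word) (i x : ℕ) : (X * Y).P i x ↔
    X.P i x ∨ (X.len ≤ x ∧ Y.P i (x - X.len)) := Iff.rfl

instance : Monoid Word where
  mul_assoc X Y Z := by
    ext b i x y
    · simp only [len_mul, add_assoc]
    · simp only [bin_mul, len_mul, Nat.sub_sub, or_assoc, and_or_left, ← and_assoc]
      refine or_congr_right (or_congr_right (and_congr_left fun _ => ?_))
      omega
    · simp only [P_mul, len_mul, Nat.sub_sub, or_assoc, and_or_left, ← and_assoc]
      refine or_congr_right (or_congr_right (and_congr_left fun _ => ?_))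
      omega
  one_mul X := by
    ext b i x y
    · exact zero_add _
    · exact (or_iff_right id).trans (and_iff_right (Nat.zero_le _))
    · exact (or_iff_right id).trans (and_iff_right (Nat.zero_le _))
  mul_one X := by
    ext b i x y
    · exact add_zero _
    · exact or_iff_left And.right
    · exact or_iff_left And.right

theorem len_pow (X : Word) (e : ℕ) : (X ^ e).len = e * X.len := by
  induction e with
  | zero => rw [pow_zero, Nat.zero_mul]; rfl
  | succ e ih => rw [pow_succ, len_mul, ih, Nat.succ_mul]

/-! ### The prefix game -/

/-- A tuple together with the two endpoints. -/
def withEnds {ι : Type} (X : Word) (xs : ι → ℕ) : ι ⊕ Fin 2 → ℕ := Sum.elim xs ![0, X.len]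

/-- The tuples satisfy the same atomic formulas in the relations of level below `n` and the
constants for the endpoints. -/
structure Agree (n : ℕ) {ι : Type} (X Y : Word) (xs ys : ι → ℕ) : Prop where
  le_iff : ∀ s t, X.withEnds xs s ≤ X.withEnds xs t ↔ Y.withEnds ys s ≤ Y.withEnds ys t
  bin_iff : ∀ b, ∀ i < n, ∀ s t,
    X.bin b i (X.withEnds xs s) (X.withEnds xs t) ↔ Y.bin b i (Y.withEnds ys s) (Y.withEnds ys t)
  P_iff : ∀ i < n, ∀ s, X.P i (X.withEnds xs s) ↔ Y.P i (Y.withEnds ys s)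

/-- The game preorder: `Σ_m` formulas with at most `k` quantifiers in each block that hold of `xs`
in `X` hold of `ys` in `Y`. -/
def Leq (n k : ℕ) : ℕ → ∀ {ι : Type} (_ _ : Word) (_ _ : ι → ℕ), Prop
  | 0 => fun X Y xs ys => Agree n X Y xs ys
  | m + 1 => fun X Y xs ys => ∀ j ≤ k, ∀ c : Fin j → ℕ, (∀ i, c i ≤ X.len) →
      ∃ d : Fin j → ℕ, (∀ i, d i ≤ Y.len) ∧ Leq n k m Y X (Sum.elim ys d) (Sum.elim xs c)

section Game

variable {n k m : ℕ} {ι ι' : Type} {X Y Z X' Y' : Word} {xs ys zs xs' ys' : ι → ℕ}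

theorem Agree.symm (h : Agree n X Y xs ys) : Agree n Y X ys xs :=
  ⟨fun s t => (h.le_iff s t).symm, fun b i hi s t => (h.bin_iff b i hi s t).symm,
    fun i hi s => (h.P_iff i hi s).symm⟩

theorem Leq.refl (X : Word) (xs : ι → ℕ) : Leq n k m X X xs xs := by
  induction m generalizing ι with
  | zero => exact ⟨fun _ _ => Iff.rfl, fun _ _ _ _ _ => Iff.rfl, fun _ _ _ => Iff.rfl⟩
  | succ m ih => exact fun j _ c hc => ⟨c, hc, ih _⟩

theorem Leq.trans (h : Leq n k m X Y xs ys) (h' : Leq n k m Y Z ys zs) :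
    Leq n k m X Z xs zs := by
  induction m generalizing ι X Y Z with
  | zero =>
    exact ⟨fun s t => (h.le_iff s t).trans (h'.le_iff s t),
      fun b i hi s t => (h.bin_iff b i hi s t).trans (h'.bin_iff b i hi s t),
      fun i hi s => (h.P_iff i hi s).trans (h'.P_iff i hi s)⟩
  | succ m ih =>
    intro j hj c hc
    obtain ⟨d, hd, h1⟩ := h j hj c hc
    obtain ⟨e, he, h2⟩ := h' j hj d hd
    exact ⟨e, he, ih h2 h1⟩

theorem Leq.comp_ext (f : ι' → ι ⊕ Fin 2) (h : Leq n k m X Y xs ys) :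
    Leq n k m X Y (X.withEnds xs ∘ f) (Y.withEnds ys ∘ f) := by
  induction m generalizing ι ι' X Y with
  | zero =>
    have key : ∀ (X : Word) (xs : ι → ℕ) (s : ι' ⊕ Fin 2),
        X.withEnds (X.withEnds xs ∘ f) s = X.withEnds xs (Sum.elim f Sum.inr s) := by
      rintro X xs (s | s) <;> rfl
    refine ⟨fun s t => ?_, fun b i hi s t => ?_, fun i hi s => ?_⟩
    · simp only [key]; exact h.le_iff _ _
    · simp only [key]; exact h.bin_iff _ _ hi _ _
    · simp only [key]; exact h.P_iff _ hi _
  | succ m ih =>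
    intro j hj c hc
    obtain ⟨d, hd, h1⟩ := h j hj c hc
    refine ⟨d, hd, ?_⟩
    have key : ∀ (X : Word) (xs : ι → ℕ) (c : Fin j → ℕ), Sum.elim (X.withEnds xs ∘ f) c =
        X.withEnds (Sum.elim xs c) ∘
          Sum.elim (fun i => (f i).map Sum.inl id) (Sum.inl ∘ Sum.inr) := by
      intro X xs c
      funext i
      rcases i with i | i
      · simp only [Sum.elim_inl, Function.comp]
        rcases f i with a | a <;> rfl
      · rfl
    rw [key, key]
    exact ih _ h1

theorem Leq.reindex (f : ι' → ι) (h : Leq n k m X Y xs ys) :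
    Leq n k m X Y (xs ∘ f) (ys ∘ f) :=
  h.comp_ext (Sum.inl ∘ f)

theorem Leq.agree (h : Leq n k m X Y xs ys) : Agree n X Y xs ys := by
  induction m generalizing ι X Y with
  | zero => exact h
  | succ m ih =>
    obtain ⟨d, _, h1⟩ := h 0 (Nat.zero_le _) Fin.elim0 (fun i => i.elim0)
    exact Leq.reindex (k := 0) (m := 0) Sum.inl (ih h1).symm

/-- The tuples `xs` of `X` and `ys` of `Y` are the two projections of a tuple of `X * Y`. -/
def Proj (X : Word) (xs ys : ι → ℕ) : Prop := ∀ i, xs i ≤ X.len ∧ (xs i = X.len ∨ ys i = 0)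

theorem Proj.withEnds (h : Proj X xs ys) (s : ι ⊕ Fin 2) : X.withEnds xs s ≤ X.len ∧
    (X.withEnds xs s = X.len ∨ Y.withEnds ys s = 0) := by
  rcases s with i | i
  · exact h i
  · fin_cases i
    · exact ⟨Nat.zero_le _, Or.inr rfl⟩
    · exact ⟨le_rfl, Or.inl rfl⟩

theorem Agree.zero_iff (h : Agree n X Y xs ys) (s : ι ⊕ Fin 2) :
    X.withEnds xs s = 0 ↔ Y.withEnds ys s = 0 := by
  simpa [Word.withEnds] using h.le_iff s (Sum.inr 0)

theorem Agree.len_iff (h : Agree n X Y xs ys) (s : ι ⊕ Fin 2) :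
    X.len ≤ X.withEnds xs s ↔ Y.len ≤ Y.withEnds ys s := by
  simpa [Word.withEnds] using h.le_iff (Sum.inr 1) s

theorem Agree.proj (h : Agree n X X' xs xs') (h' : Agree n Y Y' ys ys') (hp : Proj X xs ys)
    (hb : ∀ i, xs' i ≤ X'.len) : Proj X' xs' ys' := by
  refine fun i => ⟨hb i, ?_⟩
  have h1 := h.len_iff (Sum.inl i)
  have h2 := h'.zero_iff (Sum.inl i)
  have h3 := hp i
  have h4 := hb i
  simp only [Word.withEnds, Sum.elim_inl] at h1 h2
  omega

theorem withEnds_mul (xs ys : ι → ℕ) (s : ι ⊕ Fin 2) :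
    (X * Y).withEnds (xs + ys) s = X.withEnds xs s + Y.withEnds ys s := by
  rcases s with i | i
  · rfl
  · fin_cases i <;> rfl

theorem bin_mul_add {b : Bool} {i x y u v : ℕ} (hx : x ≤ X.len ∧ (x = X.len ∨ u = 0))
    (hy : y ≤ X.len ∧ (y = X.len ∨ v = 0)) : (X * Y).bin b i (x + u) (y + v) ↔
      (u = 0 ∧ v = 0 ∧ X.bin b i x y) ∨ (X.len ≤ x ∧ X.len ≤ y ∧ Y.bin b i u v) := by
  rw [bin_mul]
  constructor
  · rintro (h | ⟨h1, h⟩)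
    · have h2 := X.bin_lt h
      have h3 := X.bin_le h
      obtain rfl : u = 0 := by omega
      obtain rfl : v = 0 := by omega
      exact Or.inl ⟨rfl, rfl, h⟩
    · have h2 := Y.bin_lt h
      obtain rfl : x = X.len := by omega
      obtain rfl : y = X.len := by omega
      exact Or.inr ⟨le_rfl, le_rfl, by simpa using h⟩
  · rintro (⟨rfl, rfl, h⟩ | ⟨h1, h2, h⟩)
    · exact Or.inl h
    · obtain rfl : x = X.len := by omega
      obtain rfl : y = X.len := by omega
      exact Or.inr ⟨by omega, by simpa using h⟩

theorem P_mul_add {i x u : ℕ} (hx : x ≤ X.len ∧ (x = X.len ∨ u = 0)) :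
    (X * Y).P i (x + u) ↔ (u = 0 ∧ X.P i x) ∨ (X.len ≤ x ∧ Y.P i u) := by
  rw [P_mul]
  constructor
  · rintro (h | ⟨h1, h⟩)
    · have h3 := X.P_le h
      obtain rfl : u = 0 := by omega
      exact Or.inl ⟨rfl, h⟩
    · obtain rfl : x = X.len := by omega
      exact Or.inr ⟨le_rfl, by simpa using h⟩
  · rintro (⟨rfl, h⟩ | ⟨h1, h⟩)
    · exact Or.inl h
    · obtain rfl : x = X.len := by omega
      exact Or.inr ⟨by omega, by simpa using h⟩

theorem Agree.mul (h : Agree n X X' xs xs') (h' : Agree n Y Y' ys ys') (hp : Proj X xs ys)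
    (hp' : Proj X' xs' ys') : Agree n (X * Y) (X' * Y') (xs + ys) (xs' + ys') := by
  refine ⟨fun s t => ?_, fun b i hi s t => ?_, fun i hi s => ?_⟩
  · rw [withEnds_mul, withEnds_mul, withEnds_mul, withEnds_mul]
    have h1 := h.le_iff s t
    have h2 := h'.le_iff s t
    have h3 := h.len_iff s
    have h4 := h.len_iff t
    have h5 := h'.zero_iff s
    have h6 := h'.zero_iff t
    have h7 := hp.withEnds (Y := Y) s
    have h8 := hp.withEnds (Y := Y) t
    have h9 := hp'.withEnds (Y := Y') s
    have h10 := hp'.withEnds (Y := Y') t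
    omega
  · rw [withEnds_mul, withEnds_mul, withEnds_mul, withEnds_mul,
      bin_mul_add (hp.withEnds s) (hp.withEnds t),
      bin_mul_add (hp'.withEnds s) (hp'.withEnds t), h'.zero_iff, h'.zero_iff, h.len_iff, h.len_iff,
      h.bin_iff b i hi, h'.bin_iff b i hi]
  · rw [withEnds_mul, withEnds_mul, P_mul_add (hp.withEnds s), P_mul_add (hp'.withEnds s),
      h'.zero_iff, h.len_iff, h.P_iff i hi, h'.P_iff i hi]

theorem sum_elim_add {j : ℕ} (xs ys : ι → ℕ) (c d : Fin j → ℕ) :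
    Sum.elim (xs + ys) (c + d) = Sum.elim xs c + Sum.elim ys d := by
  funext i
  rcases i with i | i <;> rfl

/-- The game preorder is compatible with gluing: the two strategies are played side by side. -/
theorem Leq.mul (h : Leq n k m X X' xs xs') (h' : Leq n k m Y Y' ys ys') (hp : Proj X xs ys)
    (hp' : Proj X' xs' ys') : Leq n k m (X * Y) (X' * Y') (xs + ys) (xs' + ys') := by
  induction m generalizing ι X Y X' Y' with
  | zero => exact Agree.mul h h' hp hp'
  | succ m ih =>
    intro j hj c hc
    simp only [len_mul] at hc
    obtain ⟨d₁, hd₁, h₁⟩ := h j hj (fun i => min (c i) X.len) (fun i => min_le_right _ _)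
    obtain ⟨d₂, hd₂, h₂⟩ := h' j hj (fun i => c i - X.len) (fun i => by have := hc i; omega)
    have hc' : c = (fun i => min (c i) X.len) + (fun i => c i - X.len) := by
      funext i
      simp only [Pi.add_apply]
      omega
    have hq : Proj X (Sum.elim xs (fun i => min (c i) X.len))
        (Sum.elim ys (fun i => c i - X.len)) := by
      rintro (i | i)
      · exact hp i
      · simp only [Sum.elim_inr]
        omega
    have hq' : Proj X' (Sum.elim xs' d₁) (Sum.elim ys' d₂) := by
      refine h₁.agree.symm.proj h₂.agree.symm hq ?_
      rintro (i | i)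
      · exact (hp' i).1
      · exact hd₁ i
    refine ⟨d₁ + d₂, fun i => add_le_add (hd₁ i) (hd₂ i), ?_⟩
    rw [hc', sum_elim_add, sum_elim_add]
    exact ih h₁ h₂ hq' hq

/-! ### Idempotent powers and pumping -/

/-- There are finitely many types of tuples for the game with given parameters. -/
theorem exists_finite_type (n k m : ℕ) (ι : Type) [Finite ι] :
    ∃ (T : Type) (_ : Finite T) (f : Word → (ι → ℕ) → T),
      ∀ X Y xs ys, f X xs = f Y ys → Leq n k m X Y xs ys := by
  induction m generalizing ι with
  | zero =>
    refine ⟨(ι ⊕ Fin 2 → ι ⊕ Fin 2 → Prop) × (Bool → Fin n → ι ⊕ Fin 2 → ι ⊕ Fin 2 → Prop) ×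
      (Fin n → ι ⊕ Fin 2 → Prop), inferInstance, fun X xs =>
      (fun s t => X.withEnds xs s ≤ X.withEnds xs t,
        fun b i s t => X.bin b i (X.withEnds xs s) (X.withEnds xs t),
        fun i s => X.P i (X.withEnds xs s)), fun X Y xs ys h => ?_⟩
    simp only [Prod.mk.injEq, funext_iff, eq_iff_iff] at h
    exact ⟨h.1, fun b i hi => h.2.1 b ⟨i, hi⟩, fun i hi => h.2.2 ⟨i, hi⟩⟩
  | succ m ih =>
    choose T hT f hf using fun j : Fin (k + 1) => ih (ι ⊕ Fin j)
    refine ⟨∀ j, Set (T j), inferInstance, fun X xs j =>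
      {t | ∃ c : Fin j → ℕ, (∀ i, c i ≤ X.len) ∧ f j X (Sum.elim xs c) = t},
      fun X Y xs ys h j hj c hc => ?_⟩
    have h1 := congrFun h ⟨j, Nat.lt_succ_of_le hj⟩
    obtain ⟨d, hd, h3⟩ := (Set.ext_iff.1 h1 (f _ X (Sum.elim xs c))).1 ⟨c, hc, rfl⟩
    exact ⟨d, hd, hf _ _ _ _ _ h3⟩

/-- The game preorder on words without distinguished elements. -/
def Le (n k m : ℕ) (X Y : Word) : Prop := Leq n k m X Y (Empty.elim : Empty → ℕ) Empty.elim

theorem Le.trans (h : Le n k m X Y) (h' : Le n k m Y Z) : Le n k m X Z := Leq.trans h h'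

theorem Le.mul (h : Le n k m X X') (h' : Le n k m Y Y') : Le n k m (X * Y) (X' * Y') := by
  have := Leq.mul h h' (fun i => i.elim) (fun i => i.elim)
  rwa [Subsingleton.elim (_ + _) (Empty.elim : Empty → ℕ)] at this

/-- Some power of `X` is idempotent as far as needed: two powers of `X` have the same type, so from
some exponent on the types are periodic, and a suitable multiple of the period is taken. -/
theorem exists_pow_le (n k m : ℕ) (X : Word) :
    ∃ e, Le n k m (X ^ (e + 1) * X ^ (e + 1)) (X ^ (e + 1)) := by
  obtain ⟨T, _, f, hf⟩ := exists_finite_type n k m Empty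
  obtain ⟨i, j, hij, h⟩ := Finite.exists_ne_map_eq_of_infinite
    fun i : ℕ => f (X ^ i) (Empty.elim : Empty → ℕ)
  wlog hlt : i < j generalizing i j
  · exact this j i hij.symm h.symm (by omega)
  obtain ⟨d, rfl⟩ : ∃ d, j = i + (d + 1) := ⟨j - i - 1, by omega⟩
  have h0 : Le n k m (X ^ (i + (d + 1))) (X ^ i) := hf _ _ _ _ h.symm
  have h1 : ∀ t, i ≤ t → Le n k m (X ^ (t + (d + 1))) (X ^ t) := by
    intro t ht
    obtain ⟨t, rfl⟩ := Nat.exists_eq_add_of_le ht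
    rw [show i + t + (d + 1) = i + (d + 1) + t by omega, pow_add _ _ t, pow_add _ _ t]
    exact h0.mul (Leq.refl _ _)
  have h2 : ∀ t s, i ≤ t → Le n k m (X ^ (t + s * (d + 1))) (X ^ t) := by
    intro t s ht
    induction s with
    | zero => rw [Nat.zero_mul]; exact Leq.refl _ _
    | succ s ih =>
      rw [Nat.succ_mul, ← add_assoc]
      exact (h1 _ (by omega)).trans ih
  refine ⟨i * (d + 1) + d, ?_⟩
  have h3 : i ≤ i * (d + 1) := Nat.le_mul_of_pos_right _ d.succ_pos
  have := h2 (i * (d + 1) + d + 1) (i + 1) (by omega)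
  rwa [show (i + 1) * (d + 1) = i * (d + 1) + d + 1 by ring, pow_add] at this

theorem Le.pow_le (h : Le n k m (X * X) X) (l : ℕ) : Le n k m (X ^ (l + 1)) X := by
  induction l with
  | zero => rw [zero_add, pow_one]; exact Leq.refl _ _
  | succ l ih =>
    rw [pow_succ]
    exact (ih.mul (Leq.refl _ _)).trans h

/-- In a long power of `Y` some factor contains none of the chosen elements in its interior; this
factor may be replaced by `X`, and the factors around it may be absorbed by idempotency. -/
theorem Le.pump (h : Le n k m X Y) :
    ∃ s t u, Le n k (m + 1) (Y ^ (s + 1)) (Y ^ (t + 1) * X * Y ^ (u + 1)) := by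
  obtain ⟨e, he⟩ := exists_pow_le n k (m + 1) Y
  refine ⟨e * (k + 3) + k + 2, e, e + e, ?_⟩
  set V := Y ^ (e + 1) with hV
  have hsrc : Y ^ (e * (k + 3) + k + 2 + 1) = V ^ (k + 3) := by
    rw [hV, ← pow_mul]
    congr 1
    ring
  have htgt : V * X * Y ^ (e + e + 1) = V * ((X * Y ^ e) * V) := by
    rw [add_assoc e e 1, pow_add Y e (e + 1)]
    simp only [mul_assoc, hV]
  have hmid : Le n k m (X * Y ^ e) V := by
    rw [hV, pow_succ']
    exact h.mul (Leq.refl _ _)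
  rw [hsrc, htgt]
  intro j hj c hc
  -- a factor whose interior contains none of the elements `c i`
  obtain ⟨l, hl, hlc⟩ : ∃ l ∈ Finset.range (k + 1), ∀ i, c i / V.len ≠ l + 1 := by
    have hcard : (Finset.univ.image fun i : Fin j => c i / V.len - 1).card <
        (Finset.range (k + 1)).card := by
      refine lt_of_le_of_lt Finset.card_image_le ?_
      rw [Finset.card_univ, Fintype.card_fin, Finset.card_range]
      omega
    obtain ⟨l, hl, hl'⟩ := Finset.exists_mem_notMem_of_card_lt_card hcard
    refine ⟨l, hl, fun i hi => hl' (Finset.mem_image.2 ⟨i, Finset.mem_univ _, ?_⟩)⟩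
    simp only [hi, Nat.add_sub_cancel]
  obtain ⟨r, hr⟩ : ∃ r, k + 3 = l + 1 + (1 + (r + 1)) :=
    ⟨k - l, by have := Finset.mem_range.1 hl; omega⟩
  have hsplit : V ^ (k + 3) = V ^ (l + 1) * (V * V ^ (r + 1)) := by
    rw [hr, pow_add V (l + 1), pow_add V 1, pow_one]
  rw [hsplit] at hc ⊢
  simp only [len_mul] at hc
  set p := (V ^ (l + 1)).len with hp
  have hmidc : ∀ i, min (c i - p) V.len = 0 ∨ min (c i - p) V.len = V.len := by
    intro i
    by_contra! hcon
    refine hlc i ?_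
    rw [Nat.div_eq_iff (by omega)]
    rw [hp, len_pow] at hcon
    omega
  obtain ⟨d₁, hd₁, h₁⟩ := he.pow_le l j hj (fun i => min (c i) p) (fun i => min_le_right _ _)
  obtain ⟨d₃, hd₃, h₃⟩ := he.pow_le r j hj (fun i => c i - p - V.len)
    (fun i => by have := hc i; omega)
  have h₂ := Leq.comp_ext (fun i : Empty ⊕ Fin j => Sum.elim Empty.elim
    (fun i => Sum.inr (if min (c i - p) V.len = 0 then 0 else 1)) i) hmid
  set f : Empty ⊕ Fin j → Empty ⊕ Fin 2 := fun i => Sum.elim Empty.elim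
    (fun i => Sum.inr (if min (c i - p) V.len = 0 then 0 else 1)) i with hf
  have hVf : V.withEnds Empty.elim ∘ f = Sum.elim Empty.elim (fun i => min (c i - p) V.len) := by
    funext i
    rcases i with i | i
    · exact i.elim
    · simp only [hf, Function.comp, Sum.elim_inr, Word.withEnds]
      split_ifs with h0
      · simp [h0]
      · simpa using ((hmidc i).resolve_left h0).symm
  rw [hVf] at h₂
  have hb₂ : ∀ s, (X * Y ^ e).withEnds (Empty.elim : Empty → ℕ) s ≤ (X * Y ^ e).len := by
    rintro (s | s)
    · exact s.elim
    · fin_cases s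
      · exact Nat.zero_le _
      · exact le_rfl
  set g : Empty ⊕ Fin j → ℕ := (X * Y ^ e).withEnds Empty.elim ∘ f with hg
  have hg' : g = Sum.elim Empty.elim (fun i => g (Sum.inr i)) := by
    funext i
    rcases i with i | i
    · exact i.elim
    · rfl
  have hq : Proj V (Sum.elim (Empty.elim : Empty → ℕ) (fun i => min (c i - p) V.len))
      (Sum.elim (Empty.elim : Empty → ℕ) (fun i => c i - p - V.len)) := by
    rintro (i | i)
    · exact i.elim
    · simp only [Sum.elim_inr]
      omega
  have h₂₃ := h₂.mul h₃ (h₂.agree.symm.proj h₃.agree.symm hq fun i => hb₂ _) hq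
  have hq' : Proj (V ^ (l + 1)) (Sum.elim (Empty.elim : Empty → ℕ) (fun i => min (c i) p))
      (Sum.elim (Empty.elim : Empty → ℕ) (fun i => min (c i - p) V.len) +
        Sum.elim (Empty.elim : Empty → ℕ) (fun i => c i - p - V.len)) := by
    rintro (i | i)
    · exact i.elim
    · simp only [Sum.elim_inr, Pi.add_apply]
      omega
  have h₁₂₃ := h₁.mul h₂₃ (h₁.agree.symm.proj h₂₃.agree.symm hq' (by
    rintro (i | i)
    · exact i.elim
    · exact hd₁ i)) hq'
  refine ⟨d₁ + ((fun i => g (Sum.inr i)) + d₃), fun i => ?_, ?_⟩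
  · exact add_le_add (hd₁ i) (add_le_add (hb₂ _) (hd₃ i))
  · convert h₁₂₃ using 1
    · funext i
      rcases i with i | i
      · exact i.elim
      · rfl
    · funext i
      rcases i with i | i
      · exact i.elim
      · simp only [Sum.elim_inr, Pi.add_apply]
        omega

end Game

/-! ### Words as structures -/

/-- The universe of a word. -/
abbrev Carrier (X : Word) : Type := {x : ℕ // x ≤ X.len}

/-- The interpretation of the relation symbols of `σ_n` in a word. -/
def relMap (n : ℕ) (X : Word) : ∀ {k : ℕ}, SigRel n k → (Fin k → X.Carrier) → Prop
  | _, .le, xs => (xs 0 : ℕ) ≤ xs 1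
  | _, .S i _ _, xs => X.bin true (i - 1) (xs 0) (xs 1)
  | _, .R i _ _, xs => X.bin false (i - 1) (xs 0) (xs 1)
  | _, .P i _ _, xs => X.P (i - 1) (xs 0)

/-- The word as a structure for `σ_n`. -/
@[reducible] def sigStr (n : ℕ) (X : Word) : (Sig n).Structure X.Carrier where
  funMap f _ := Empty.elim f
  RelMap := X.relMap n

/-- The endpoints of a word. -/
def endpts (X : Word) : Fin 2 → X.Carrier := ![⟨0, Nat.zero_le _⟩, ⟨X.len, le_rfl⟩]

/-- The word as a structure with its endpoints as constants. -/
@[reducible] def str (n : ℕ) (X : Word) : (SigC n).Structure X.Carrier :=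
  letI := X.sigStr n
  letI := constantsOn.structure X.endpts
  withConstantsStructure (Sig n) (Fin 2)

section Preservation

variable {n : ℕ}

attribute [local instance] Word.str

/-- The value of an atomic term, as a natural number. -/
theorem exists_withEnds_eq {r : ℕ} (t : (SigC n).Term (Empty ⊕ Fin r)) :
    ∃ s : Fin r ⊕ Fin 2, ∀ (X : Word) (xs : Fin r → X.Carrier),
      ((t.realize (Sum.elim Empty.elim xs) : X.Carrier) : ℕ) =
        X.withEnds (fun i => (xs i : ℕ)) s := by
  cases t with
  | var a =>
    rcases a with a | a
    · exact a.elim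
    · exact ⟨Sum.inl a, fun X xs => rfl⟩
  | @func l f ts =>
    rcases f with f | f
    · exact Empty.elim f
    · rcases l with _ | l
      · refine ⟨Sum.inr f, fun X xs => ?_⟩
        have : ∀ i : Fin 2, (X.endpts i : ℕ) = ![0, X.len] i := by
          intro i
          fin_cases i <;> rfl
        exact this f
      · exact PEmpty.elim f

theorem Agree.realize_iff {r : ℕ} {φ : (SigC n).BoundedFormula Empty r} (hφ : φ.IsQF)
    {X Y : Word} {xs : Fin r → X.Carrier} {ys : Fin r → Y.Carrier}
    (h : Agree n X Y (fun i => (xs i : ℕ)) (fun i => (ys i : ℕ))) :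
    φ.Realize Empty.elim xs ↔ φ.Realize Empty.elim ys := by
  induction hφ with
  | falsum => exact Iff.rfl
  | imp _ _ ih₁ ih₂ => exact imp_congr ih₁ ih₂
  | of_isAtomic h' =>
    cases h' with
    | equal t₁ t₂ =>
      obtain ⟨s₁, h₁⟩ := exists_withEnds_eq t₁
      obtain ⟨s₂, h₂⟩ := exists_withEnds_eq t₂
      simp only [BoundedFormula.realize_bdEqual, Subtype.ext_iff, h₁, h₂]
      have h3 := h.le_iff s₁ s₂
      have h4 := h.le_iff s₂ s₁
      omega
    | @rel l R ts =>
      choose s hs using fun i => exists_withEnds_eq (ts i)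
      simp only [BoundedFormula.realize_rel]
      rcases R with R | R
      · change X.relMap n R _ ↔ Y.relMap n R _
        cases R with
        | le => simp only [relMap, hs]; exact h.le_iff _ _
        | S i h₁ h₂ => simp only [relMap, hs]; exact h.bin_iff _ _ (by omega) _ _
        | R i h₁ h₂ => simp only [relMap, hs]; exact h.bin_iff _ _ (by omega) _ _
        | P i h₁ h₂ => simp only [relMap, hs]; exact h.P_iff _ (by omega) _
      · exact Empty.elim R

/-- The formula has the truth value `b`. -/
def Holds (b : Bool) {r : ℕ} (φ : (SigC n).BoundedFormula Empty r) (X : Word)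
    (xs : Fin r → X.Carrier) : Prop :=
  φ.Realize Empty.elim xs ↔ b = true

theorem holds_quant {b : Bool} {r : ℕ} {φ : (SigC n).BoundedFormula Empty (r + 1)} {X : Word}
    {xs : Fin r → X.Carrier} : Holds b (quant b φ) X xs ↔ ∃ x, Holds b φ X (Fin.snoc xs x) := by
  cases b <;> simp [Holds, quant]

theorem holds_not {b : Bool} {r : ℕ} {φ : (SigC n).BoundedFormula Empty r} {X : Word}
    {xs : Fin r → X.Carrier} : Holds (!b) φ X xs ↔ ¬ Holds b φ X xs := by
  cases b <;> simp [Holds]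

/-- The truth value `b` of `φ` is passed on by the game preorder with `m` rounds. -/
def Passes (b : Bool) (m : ℕ) {r : ℕ} (φ : (SigC n).BoundedFormula Empty r) : Prop :=
  ∃ K, ∀ k ≥ K, ∀ (X Y : Word) (xs : Fin r → X.Carrier) (ys : Fin r → Y.Carrier),
    Leq n k m X Y (fun i => (xs i : ℕ)) (fun i => (ys i : ℕ)) → Holds b φ X xs → Holds b φ Y ys

/-- A tuple witnessing that `φ` has the truth value `b` in `X` can be chosen such that every answer
to it that is good for `m` rounds shows that `φ` has this truth value. -/
def HasWitness (b : Bool) (m : ℕ) {r : ℕ} (φ : (SigC n).BoundedFormula Empty r) : Prop :=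
  ∃ K, ∀ k ≥ K, ∀ (X : Word) (xs : Fin r → X.Carrier), Holds b φ X xs →
    ∃ j ≤ K, ∃ c : Fin j → ℕ, (∀ i, c i ≤ X.len) ∧
      ∀ (Y : Word) (ys : Fin r → Y.Carrier) (d : Fin j → ℕ), (∀ i, d i ≤ Y.len) →
        Leq n k m Y X (Sum.elim (fun i => (ys i : ℕ)) d) (Sum.elim (fun i => (xs i : ℕ)) c) →
          Holds b φ Y ys

theorem HasWitness.passes {b : Bool} {m r : ℕ} {φ : (SigC n).BoundedFormula Empty r}
    (h : HasWitness b m φ) : Passes b (m + 1) φ := by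
  obtain ⟨K, h⟩ := h
  refine ⟨K, fun k hk X Y xs ys hle hX => ?_⟩
  obtain ⟨j, hj, c, hc, H⟩ := h k hk X xs hX
  obtain ⟨d, hd, hle'⟩ := hle j (hj.trans hk) c hc
  exact H Y ys d hd hle'

theorem coe_snoc {r : ℕ} {X : Word} (xs : Fin r → X.Carrier) (x : X.Carrier) (i : Fin (r + 1)) :
    ((Fin.snoc (α := fun _ => X.Carrier) xs x i : X.Carrier) : ℕ) =
      Fin.lastCases (motive := fun _ => ℕ) (x : ℕ) (fun i => (xs i : ℕ)) i := by
  refine Fin.lastCases ?_ (fun i => ?_) i <;> simp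

theorem passes_and_hasWitness {b : Bool} {m r : ℕ} {φ : (SigC n).BoundedFormula Empty r}
    (h : PrefixClass b m φ) : Passes b m φ ∧ ∀ m', m = m' + 1 → HasWitness b m' φ := by
  induction h using PrefixClass.quantInduction with
  | @qf b m r φ hq =>
    refine ⟨⟨0, fun k _ X Y xs ys hle hX => ?_⟩, fun m' _ => ⟨0, fun k _ X xs hX =>
      ⟨0, le_rfl, Fin.elim0, fun i => i.elim0, fun Y ys d _ hle => ?_⟩⟩⟩
    · exact (hle.agree.realize_iff hq).symm.trans hX
    · exact ((hle.reindex Sum.inl).agree.realize_iff hq).trans hX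
  | @same b m r φ h ih =>
    suffices H : HasWitness b m (quant b φ) from
      ⟨H.passes, fun m' hm => (show m = m' by omega) ▸ H⟩
    obtain ⟨K, hK⟩ := ih.2 m rfl
    refine ⟨K + 1, fun k hk X xs hX => ?_⟩
    obtain ⟨x, hx⟩ := holds_quant.1 hX
    obtain ⟨j, hj, c, hc, H⟩ := hK k (by omega) X _ hx
    refine ⟨j + 1, by omega, Fin.cons (x : ℕ) c, Fin.cases x.2 hc, fun Y ys d hd hle => ?_⟩
    refine holds_quant.2 ⟨⟨d 0, hd 0⟩, H Y _ (fun i => d i.succ) (fun i => hd _) ?_⟩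
    convert hle.reindex (Sum.elim (Fin.lastCases (Sum.inr 0) Sum.inl)
      (fun i : Fin j => Sum.inr i.succ)) using 1
    · funext i
      rcases i with i | i
      · simp only [Sum.elim_inl, coe_snoc, Function.comp]
        refine Fin.lastCases ?_ (fun i => ?_) i <;> simp
      · rfl
    · funext i
      rcases i with i | i
      · simp only [Sum.elim_inl, coe_snoc, Function.comp]
        refine Fin.lastCases ?_ (fun i => ?_) i <;> simp
      · rfl
  | @switch b m r φ h ih =>
    suffices H : HasWitness b m (quant b φ) from
      ⟨H.passes, fun m' hm => (show m = m' by omega) ▸ H⟩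
    obtain ⟨K, hK⟩ := ih.1
    refine ⟨K + 1, fun k hk X xs hX => ?_⟩
    obtain ⟨x, hx⟩ := holds_quant.1 hX
    refine ⟨1, by omega, fun _ => x, fun _ => x.2, fun Y ys d hd hle => ?_⟩
    refine holds_quant.2 ⟨⟨d 0, hd 0⟩, not_not.1 fun hY => ?_⟩
    refine holds_not.1 (hK k (by omega) Y X _ _ ?_ (holds_not.2 hY)) hx
    convert hle.reindex (Fin.lastCases (Sum.inr 0) Sum.inl) using 1
    · funext i
      simp only [coe_snoc, Function.comp]
      refine Fin.lastCases ?_ (fun i => ?_) i <;> simp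
    · funext i
      simp only [coe_snoc, Function.comp]
      refine Fin.lastCases ?_ (fun i => ?_) i <;> simp

/-- `Σ_m` sentences are preserved by the game preorder with `m` rounds. -/
theorem exists_le_imp_realize {m : ℕ} {ψ : (SigC n).Sentence} (hψ : IsSigma m ψ) :
    ∃ k, ∀ X Y : Word, Le n k m X Y → X.Carrier ⊨ ψ → Y.Carrier ⊨ ψ := by
  obtain ⟨K, hK⟩ := (passes_and_hasWitness hψ).1
  refine ⟨K, fun X Y hle hX => ?_⟩
  have key : ∀ X : Word, X.Carrier ⊨ ψ ↔ Holds true ψ X default := by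
    intro X
    simp only [Holds, Sentence.Realize, Formula.Realize, iff_true]
    rw [Subsingleton.elim (default : Empty → X.Carrier) Empty.elim]
  rw [key] at hX ⊢
  refine hK K le_rfl X Y default default ?_ hX
  convert Leq.reindex (Fin.elim0 : Fin 0 → Empty) hle

/-! ### The meaning of the sentence in a word -/

theorem rels_lin (X : Word) : X.rels.Lin :=
  ⟨fun _ => le_rfl, fun _ _ => le_antisymm, fun _ _ _ => le_trans, le_total⟩

theorem toRelsC_le {X : Word} (x y : X.Carrier) :
    (toRelsC n X.Carrier).le x y ↔ (x : ℕ) ≤ y := Iff.rfl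

theorem toRelsC_bin {X : Word} (b : Bool) (i : ℕ) (x y : X.Carrier) :
    (toRelsC n X.Carrier).bin b i x y ↔ i < n ∧ X.bin b i x y := by
  cases b
  · exact ⟨fun ⟨h, H⟩ => ⟨h, H⟩, fun ⟨h, H⟩ => ⟨h, H⟩⟩
  · exact ⟨fun ⟨h, H⟩ => ⟨h, H⟩, fun ⟨h, H⟩ => ⟨h, H⟩⟩

theorem toRelsC_P {X : Word} (i : ℕ) (x : X.Carrier) :
    (toRelsC n X.Carrier).P i x ↔ 0 < i ∧ i < n ∧ X.P i x :=
  ⟨fun ⟨h, h', H⟩ => ⟨Nat.succ_lt_succ_iff.1 h, h', H⟩,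
    fun ⟨h, h', H⟩ => ⟨Nat.succ_lt_succ h, h', H⟩⟩

theorem realize_orderedMinMax (X : Word) : X.Carrier ⊨ orderedMinMax n := by
  rw [ExtPres.realize_orderedMinMax]
  refine ⟨X.rels_lin.comap Subtype.val_injective fun x y => (toRelsC_le x y).symm, fun x => ?_⟩
  exact ⟨Nat.zero_le _, x.2⟩

theorem realize_phi {i : ℕ} (X : Word) (hP : ∀ x, ¬ X.P 0 x) : X.Carrier ⊨ phi (i + 1) ↔
    ¬ X.rels.PS i (Set.Iic X.len) ∨
      (X.bin false i 0 X.len ∧ X.rels.Tot i 0 X.len) := by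
  rw [ExtPres.realize_phi]
  have hlin : (toRelsC (i + 1) X.Carrier).Lin :=
    X.rels_lin.comap Subtype.val_injective fun x y => (toRelsC_le x y).symm
  have hloc : Rels.LocalEmb (toRelsC (i + 1) X.Carrier) X.rels Set.univ Subtype.val :=
    ⟨fun _ _ _ _ _ _ _ => trivial, fun x _ y _ => (toRelsC_le x y).symm,
      Subtype.val_injective.injOn, fun x _ y _ w _ h => ⟨⟨w, le_trans h y.2⟩, trivial, rfl⟩⟩
  have hP' : ∀ j ≤ i, ∀ x ∈ Set.univ,
      (X.rels.P j (x : X.Carrier) ↔ (toRelsC (i + 1) X.Carrier).P j x) := by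
    intro j hj x _
    rw [toRelsC_P]
    refine ⟨fun h => ⟨Nat.pos_of_ne_zero ?_, by omega, h⟩, fun h => h.2.2⟩
    rintro rfl
    exact hP _ h
  have hB : ∀ b, ∀ j ≤ i, ∀ x ∈ Set.univ, ∀ y ∈ Set.univ,
      (X.rels.bin b j (x : X.Carrier) (y : X.Carrier) ↔
        (toRelsC (i + 1) X.Carrier).bin b j x y) := by
    intro b j hj x _ y _
    rw [toRelsC_bin]
    exact ⟨fun h => ⟨by omega, h⟩, fun h => h.2⟩
  have hs := hloc.suc_iff i hP' (hB true) fun j hj => hB false j hj.le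
  have h1 := hloc.PSOf_iff (hP' i le_rfl) hs subset_rfl
  rw [Set.image_univ, Subtype.range_val_subtype] at h1
  have h2 := hloc.TotOf_iff (hP' i le_rfl) hs (Set.mem_univ (X.endpts 0))
    (Set.mem_univ (X.endpts 1))
  have h3 := hB false i le_rfl _ (Set.mem_univ (X.endpts 0)) _ (Set.mem_univ (X.endpts 1))
  simp only [Rels.Phi, hlin, not_true_eq_false, false_or]
  exact or_congr (not_congr h1.symm) (and_congr h3.symm h2.symm)

end Preservation

/-! ### Properties of products -/

/-- The word is nontrivial and uses the relations of level at most `i` only, and at each positive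
level up to `i` both of its endpoints are marked. The latter makes the product well-behaved: gluing
does not change the marks on either factor. -/
structure IsLevel (i : ℕ) (X : Word) : Prop where
  pos : 0 < X.len
  mark : ∀ j, 0 < j → j ≤ i → X.P j 0 ∧ X.P j X.len
  P_level : ∀ {j x}, X.P j x → 0 < j ∧ j ≤ i
  bin_level : ∀ {b j x y}, X.bin b j x y → j ≤ i

/-- `Total_{i+1}` holds between the endpoints. -/
def IsTotal (i : ℕ) (X : Word) : Prop := X.rels.Tot i 0 X.len

/-- `∃ x ∃ y (R_{i+1}(x, y) ∧ Total_{i+1}(x, y))`. -/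
def HasTotal (i : ℕ) (X : Word) : Prop := ∃ x y, X.bin false i x y ∧ X.rels.Tot i x y

/-- `PartialSucc_{i+1}`. -/
def IsPartial (i : ℕ) (X : Word) : Prop := X.rels.PS i (Set.Iic X.len)

theorem str_iff {i : ℕ} {X : Word} :
    X.rels.STR i (Set.Iic X.len) ↔ ¬ X.IsPartial i ∨ X.HasTotal i := by
  refine or_congr_right ⟨fun ⟨x, _, y, _, h⟩ => ⟨x, y, h⟩, fun ⟨x, y, h⟩ => ⟨x, ?_, y, ?_, h⟩⟩
  · exact (X.bin_lt h.1).le.trans (X.bin_le h.1)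
  · exact X.bin_le h.1

theorem pow_induction {C : Word → Prop} (hC : ∀ X Y, C X → C Y → C (X * Y)) {X : Word} (h : C X)
    (s : ℕ) : C (X ^ (s + 1)) := by
  induction s with
  | zero => rwa [zero_add, pow_one]
  | succ s ih => rw [pow_succ]; exact hC _ _ ih h

section Mul

variable {i : ℕ} {X Y : Word}

theorem IsLevel.mul (hX : X.IsLevel i) (hY : Y.IsLevel i) : (X * Y).IsLevel i where
  pos := Nat.add_pos_left hX.pos _
  mark j h1 h2 := by
    refine ⟨Or.inl (hX.mark j h1 h2).1, Or.inr ⟨Nat.le_add_right _ _, ?_⟩⟩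
    rw [len_mul, Nat.add_sub_cancel_left]
    exact (hY.mark j h1 h2).2
  P_level := by
    rintro j x (h | ⟨_, h⟩)
    · exact hX.P_level h
    · exact hY.P_level h
  bin_level := by
    rintro b j x y (h | ⟨_, h⟩)
    · exact hX.bin_level h
    · exact hY.bin_level h

theorem localEmb_left : Rels.LocalEmb X.rels (X * Y).rels (Set.Iic X.len) id where
  convex _ _ _ hy _ _ h := le_trans h hy
  le_iff _ _ _ _ := Iff.rfl
  inj := Function.injective_id.injOn
  surj _ _ _ hy w _ h := ⟨w, le_trans h hy, rfl⟩

theorem localEmb_right : Rels.LocalEmb Y.rels (X * Y).rels (Set.Iic Y.len) (X.len + ·) where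
  convex _ _ _ hy _ _ h := le_trans h hy
  le_iff _ _ _ _ := Nat.add_le_add_iff_left
  inj := (add_right_injective X.len).injOn
  surj x _ y hy w h₁ h₂ := by
    simp only [rels, Set.mem_Iic] at *
    exact ⟨w - X.len, by omega, by omega⟩

theorem bin_mul_left {b : Bool} {j x y : ℕ} (hy : y ≤ X.len) :
    (X * Y).bin b j x y ↔ X.bin b j x y := by
  rw [bin_mul, or_iff_left]
  rintro ⟨_, h⟩
  have := Y.bin_lt h
  omega

theorem bin_mul_right {b : Bool} {j x y : ℕ} :
    (X * Y).bin b j (X.len + x) (X.len + y) ↔ Y.bin b j x y := by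
  rw [bin_mul, Nat.add_sub_cancel_left, Nat.add_sub_cancel_left, or_iff_right,
    and_iff_right (Nat.le_add_right _ _)]
  intro h
  have h1 := X.bin_lt h
  have h2 := X.bin_le h
  omega

theorem IsLevel.P_mul_left (hX : X.IsLevel i) (hY : Y.IsLevel i) {j x : ℕ} (hx : x ≤ X.len) :
    (X * Y).P j x ↔ X.P j x := by
  rw [P_mul, or_iff_left_of_imp]
  rintro ⟨h1, h⟩
  obtain rfl : x = X.len := by omega
  obtain ⟨h2, h3⟩ := hY.P_level h
  exact (hX.mark j h2 h3).2

theorem IsLevel.P_mul_right (hX : X.IsLevel i) (hY : Y.IsLevel i) {j x : ℕ} :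
    (X * Y).P j (X.len + x) ↔ Y.P j x := by
  rw [P_mul, Nat.add_sub_cancel_left, and_iff_right (Nat.le_add_right _ _), or_iff_right_of_imp]
  intro h
  have h1 := X.P_le h
  obtain rfl : x = 0 := by omega
  obtain ⟨h2, h3⟩ := hX.P_level h
  exact (hY.mark j h2 h3).1

theorem IsLevel.suc_mul_left (hX : X.IsLevel i) (hY : Y.IsLevel i) :
    ∀ x ∈ Set.Iic X.len, ∀ y ∈ Set.Iic X.len,
      ((X * Y).rels.suc i (id x) (id y) ↔ X.rels.suc i x y) :=
  localEmb_left.suc_iff i (fun _ _ _ hx => hX.P_mul_left hY hx)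
    (fun _ _ _ _ _ hy => bin_mul_left hy) (fun _ _ _ _ _ hy => bin_mul_left hy)

theorem IsLevel.suc_mul_right (hX : X.IsLevel i) (hY : Y.IsLevel i) :
    ∀ x ∈ Set.Iic Y.len, ∀ y ∈ Set.Iic Y.len,
      ((X * Y).rels.suc i (X.len + x) (X.len + y) ↔ Y.rels.suc i x y) :=
  localEmb_right.suc_iff i (fun _ _ _ _ => hX.P_mul_right hY)
    (fun _ _ _ _ _ _ => bin_mul_right) (fun _ _ _ _ _ _ => bin_mul_right)

theorem IsLevel.tot_mul_left (hX : X.IsLevel i) (hY : Y.IsLevel i) {x y : ℕ} (hx : x ≤ X.len)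
    (hy : y ≤ X.len) : (X * Y).rels.Tot i x y ↔ X.rels.Tot i x y :=
  localEmb_left.TotOf_iff (fun _ hx => hX.P_mul_left hY hx) (hX.suc_mul_left hY) hx hy

theorem IsLevel.tot_mul_right (hX : X.IsLevel i) (hY : Y.IsLevel i) {x y : ℕ} (hx : x ≤ Y.len)
    (hy : y ≤ Y.len) : (X * Y).rels.Tot i (X.len + x) (X.len + y) ↔ Y.rels.Tot i x y :=
  localEmb_right.TotOf_iff (fun _ _ => hX.P_mul_right hY) (hX.suc_mul_right hY) hx hy

theorem isTotal_mul (hX : X.IsLevel i) (hY : Y.IsLevel i) :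
    (X * Y).IsTotal i ↔ X.IsTotal i ∧ Y.IsTotal i := by
  unfold IsTotal
  rw [← hX.tot_mul_left hY (Nat.zero_le _) le_rfl, ← hX.tot_mul_right hY (Nat.zero_le _) le_rfl,
    add_zero, len_mul]
  have hXp := hX.pos
  have hYp := hY.pos
  have hpt : (X * Y).rels.Pt i X.len := by
    rcases Nat.eq_zero_or_pos i with h | h
    · exact Or.inl h
    · exact Or.inr ((hX.P_mul_left hY le_rfl).2 (hX.mark i h le_rfl).2)
  constructor
  · rintro ⟨h0, _, h⟩
    refine ⟨⟨h0, ⟨Nat.zero_le _, by omega⟩, fun z hz h1 h2 => ?_⟩, hpt,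
      ⟨Nat.le_add_right _ _, by omega⟩, fun z hz h1 h2 => ?_⟩
    · have h3 : z ≤ X.len ∧ z ≠ X.len := h2
      obtain ⟨w, hw1, hw2, hw3⟩ := h z hz h1 ⟨show z ≤ _ by omega, by omega⟩
      refine ⟨w, hw1, ?_, hw3⟩
      -- no step leads across the gluing point
      rcases hw3.bin with h4 | h4
      · exact X.bin_le h4
      · omega
    · exact h z hz (Nat.zero_le _) h2
  · rintro ⟨⟨h0, _, h⟩, ⟨_, _, h'⟩⟩
    refine ⟨h0, ⟨Nat.zero_le _, by omega⟩, fun z hz h1 h2 => ?_⟩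
    rcases lt_or_ge z X.len with h3 | h3
    · obtain ⟨w, hw1, hw2, hw3⟩ := h z hz h1 ⟨h3.le, h3.ne⟩
      exact ⟨w, hw1, le_trans hw2 (Nat.le_add_right _ _), hw3⟩
    · exact h' z hz h3 h2

theorem hasTotal_mul (hX : X.IsLevel i) (hY : Y.IsLevel i) :
    (X * Y).HasTotal i ↔ X.HasTotal i ∨ Y.HasTotal i := by
  constructor
  · rintro ⟨x, y, h | ⟨h1, h⟩, hT⟩
    · have h2 := X.bin_lt h
      have h3 := X.bin_le h
      exact Or.inl ⟨x, y, h, (hX.tot_mul_left hY (by omega) h3).1 hT⟩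
    · have h2 := Y.bin_lt h
      have h3 := Y.bin_le h
      refine Or.inr ⟨_, _, h, (hX.tot_mul_right hY (by omega) h3).1 ?_⟩
      rwa [Nat.add_sub_cancel' h1, Nat.add_sub_cancel' (by omega)]
  · rintro (⟨x, y, h, hT⟩ | ⟨x, y, h, hT⟩)
    · have h2 := X.bin_lt h
      have h3 := X.bin_le h
      exact ⟨x, y, Or.inl h, (hX.tot_mul_left hY (by omega) h3).2 hT⟩
    · have h2 := Y.bin_lt h
      have h3 := Y.bin_le h
      exact ⟨_, _, bin_mul_right.2 h, (hX.tot_mul_right hY (by omega) h3).2 hT⟩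

theorem IsPartial.mul (hX : X.IsLevel i) (hY : Y.IsLevel i) (h : X.IsPartial i)
    (h' : Y.IsPartial i) : (X * Y).IsPartial i := by
  have h1 := (localEmb_left.PSOf_iff (fun _ hx => hX.P_mul_left hY hx) (hX.suc_mul_left hY)
    subset_rfl).2 h
  have h2 := (localEmb_right.PSOf_iff (fun _ _ => hX.P_mul_right hY) (hX.suc_mul_right hY)
    subset_rfl).2 h'
  rw [Set.image_id] at h1
  have hmem : ∀ z, X.len ≤ z → z ≤ (X * Y).len → z ∈ (X.len + ·) '' Set.Iic Y.len := by
    intro z hz hz'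
    rw [len_mul] at hz'
    exact ⟨z - X.len, show z - X.len ≤ Y.len by omega, show X.len + (z - X.len) = z by omega⟩
  intro x hx y hy hxy
  have hlt : x < y := (X * Y).bin_lt hxy.bin
  rcases hxy.bin with h3 | ⟨h3, -⟩
  · have h4 : y ≤ X.len := X.bin_le h3
    obtain ⟨h5, h6⟩ := h1 x (hlt.le.trans h4) y h4 hxy
    refine ⟨h5, fun z hz hPz => ?_⟩
    rcases le_total z X.len with h7 | h7
    · exact h6 z h7 hPz
    · exact Or.inr (le_trans h4 h7)
  · obtain ⟨h5, h6⟩ := h2 x (hmem x h3 hx) y (hmem y (h3.trans hlt.le) hy) hxy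
    refine ⟨h5, fun z hz hPz => ?_⟩
    rcases le_total X.len z with h7 | h7
    · exact h6 z (hmem z h7 hz) hPz
    · exact Or.inl (le_trans h7 h3)

end Mul

/-! ### Decorating the endpoints -/

/-- Adds to the pair of endpoints the binary relations chosen by `E`, and to both endpoints the
unary relations chosen by `Q`. -/
def decorate (E : Bool → ℕ → Prop) (Q : ℕ → Prop) (X : Word) : Word where
  len := X.len
  bin b i x y := X.bin b i x y ∨ (E b i ∧ x = 0 ∧ y = X.len ∧ x < y)
  P i x := X.P i x ∨ (Q i ∧ (x = 0 ∨ x = X.len))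
  bin_lt := by
    rintro b i x y (h | h)
    · exact X.bin_lt h
    · exact h.2.2.2
  bin_le := by
    rintro b i x y (h | h)
    · exact X.bin_le h
    · exact h.2.2.1.le
  P_le := by
    rintro i x (h | ⟨_, rfl | rfl⟩)
    · exact X.P_le h
    · exact Nat.zero_le _
    · exact le_rfl

section Decorate

variable {E : Bool → ℕ → Prop} {Q : ℕ → Prop} {X Y : Word} {n k m i : ℕ}

theorem Leq.decorate {ι : Type} {xs ys : ι → ℕ} (h : Leq n k m X Y xs ys) :
    Leq n k m (X.decorate E Q) (Y.decorate E Q) xs ys := by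
  induction m generalizing ι X Y with
  | zero =>
    have h0 : ∀ s, X.withEnds xs s = 0 ↔ Y.withEnds ys s = 0 := Agree.zero_iff h
    have h1 : ∀ s, X.withEnds xs s = X.len ↔ Y.withEnds ys s = Y.len := by
      intro s
      have h1 := Agree.len_iff h s
      have h2 := Agree.le_iff h s (Sum.inr 1)
      simp only [withEnds, Sum.elim_inr, Matrix.cons_val_one, Matrix.cons_val_fin_one] at h1 h2 ⊢
      omega
    refine ⟨h.le_iff, fun b i hi s t => ?_, fun i hi s => ?_⟩
    · refine or_congr (h.bin_iff b i hi s t) (and_congr_right fun _ => and_congr (h0 s)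
        (and_congr (h1 t) ?_))
      have h2 := Agree.le_iff h t s
      change X.withEnds xs s < X.withEnds xs t ↔ Y.withEnds ys s < Y.withEnds ys t
      omega
    · exact or_congr (h.P_iff i hi s) (and_congr_right fun _ => or_congr (h0 s) (h1 s))
  | succ m ih =>
    intro j hj c hc
    obtain ⟨d, hd, h1⟩ := h j hj c hc
    exact ⟨d, hd, ih h1⟩

theorem localEmb_decorate :
    Rels.LocalEmb X.rels (X.decorate E Q).rels Set.univ id where
  convex _ _ _ _ _ _ _ := trivial
  le_iff _ _ _ _ := Iff.rfl
  inj := Function.injective_id.injOn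
  surj _ _ _ _ w _ _ := ⟨w, trivial, rfl⟩

/-- The decoration does not touch the relations that `Succ_{i+1}` refers to. -/
structure Spares (i : ℕ) (E : Bool → ℕ → Prop) (Q : ℕ → Prop) : Prop where
  P : ∀ j ≤ i, ¬ Q j
  S : ∀ j ≤ i, ¬ E true j
  R : ∀ j < i, ¬ E false j

theorem suc_decorate (h : Spares i E Q) : ∀ x ∈ Set.univ, ∀ y ∈ Set.univ,
    ((X.decorate E Q).rels.suc i (id x) (id y) ↔ X.rels.suc i x y) :=
  localEmb_decorate.suc_iff i (fun j hj _ _ => or_iff_left fun h' => h.P j hj h'.1)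
    (fun j hj _ _ _ _ => or_iff_left fun h' => h.S j hj h'.1)
    (fun j hj _ _ _ _ => or_iff_left fun h' => h.R j hj h'.1)

theorem tot_decorate (h : Spares i E Q) {x y : ℕ} :
    (X.decorate E Q).rels.Tot i x y ↔ X.rels.Tot i x y :=
  localEmb_decorate.TotOf_iff (fun _ _ => or_iff_left fun h' => h.P i le_rfl h'.1)
    (suc_decorate h) trivial trivial

theorem isPartial_decorate (h : Spares i E Q) : (X.decorate E Q).IsPartial i ↔ X.IsPartial i := by
  have := (localEmb_decorate (X := X) (E := E) (Q := Q)).PSOf_iff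
    (fun _ _ => or_iff_left fun h' => h.P i le_rfl h'.1)
    (suc_decorate (X := X) h) (Set.subset_univ (Set.Iic X.len))
  rwa [Set.image_id] at this

theorem str_decorate (h : Spares i E Q) (hi : ¬ E false i) (U : Set ℕ) :
    (X.decorate E Q).rels.STR i (id '' U) ↔ X.rels.STR i U :=
  (localEmb_decorate (X := X) (E := E) (Q := Q)).STROf_iff
    (fun _ _ => or_iff_left fun h' => h.P i le_rfl h'.1)
    (fun _ _ _ _ => or_iff_left fun h' => hi h'.1) (suc_decorate h) (Set.subset_univ U)

end Decorate

/-! ### The two sequences of words -/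

section Construction

variable {n k i : ℕ}

theorem isTotal_pow {X : Word} (hX : X.IsLevel i) (h : X.IsTotal i) (s : ℕ) :
    (X ^ (s + 1)).IsLevel i ∧ (X ^ (s + 1)).IsTotal i :=
  pow_induction (C := fun X => X.IsLevel i ∧ X.IsTotal i)
    (fun _ _ h h' => ⟨h.1.mul h'.1, (isTotal_mul h.1 h'.1).2 ⟨h.2, h'.2⟩⟩) ⟨hX, h⟩ s

/-- Words in which `R_{i+1}` is empty and `PartialSucc_{i+1}` holds. -/
structure IsPlain (i : ℕ) (X : Word) : Prop where
  level : X.IsLevel i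
  no_R : ∀ x y, ¬ X.bin false i x y
  isPartial : X.IsPartial i

theorem IsPlain.mul {X Y : Word} (hX : X.IsPlain i) (hY : Y.IsPlain i) : (X * Y).IsPlain i where
  level := hX.level.mul hY.level
  no_R := by
    rintro x y (h | ⟨_, h⟩)
    · exact hX.no_R _ _ h
    · exact hY.no_R _ _ h
  isPartial := hX.isPartial.mul hX.level hY.level hY.isPartial

/-- A pair of words that are similar for `2i + 1` rounds and of which exactly the second one
satisfies `Total_{i+1}(a, b)`. -/
def PlainPair (n k i : ℕ) : Prop := ∃ X Y : Word, Le n k (2 * i + 1) X Y ∧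
  X.IsPlain i ∧ Y.IsPlain i ∧ Y.IsTotal i ∧ ¬ X.IsTotal i

/-- A pair of words that are similar for `2i + 2` rounds, the first of which satisfies
`R_{i+1}(a, b) ∧ Total_{i+1}(a, b)`, while the second satisfies `PartialSucc_{i+1}` and has no pair
of elements with `R_{i+1}(x, y) ∧ Total_{i+1}(x, y)` at all. -/
def MainPair (n k i : ℕ) : Prop := ∃ A B : Word, Le n k (2 * i + 2) A B ∧
  A.IsLevel i ∧ B.IsLevel i ∧ A.bin false i 0 A.len ∧ A.IsTotal i ∧
  B.IsPartial i ∧ ¬ B.HasTotal i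

/-- The two-element order, and the three-element order with its successor relation as `S_1`. -/
theorem plainPair_zero (n k : ℕ) : PlainPair n k 0 := by
  let X : Word := ⟨1, fun _ _ _ _ => False, fun _ _ => False, False.elim, False.elim, False.elim⟩
  let Y : Word := ⟨2, fun b i x y => b = true ∧ i = 0 ∧ y = x + 1 ∧ y ≤ 2, fun _ _ => False,
    fun h => by omega, fun h => h.2.2.2, False.elim⟩
  have hXY : Le n k 1 X Y := by
    -- `x ↦ 2x` is an embedding that preserves the endpoints
    intro j _ c hc
    refine ⟨fun i => 2 * c i, fun i => Nat.mul_le_mul_left 2 (hc i), ?_⟩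
    have key : ∀ s, Y.withEnds (Sum.elim (Empty.elim : Empty → ℕ) fun i => 2 * c i) s =
        2 * X.withEnds (Sum.elim (Empty.elim : Empty → ℕ) c) s := by
      rintro ((s | s) | s)
      · exact s.elim
      · rfl
      · fin_cases s <;> rfl
    refine ⟨fun s t => ?_, fun b i _ s t => ?_, fun i _ s => Iff.rfl⟩
    · rw [key, key]
      omega
    · rw [key, key]
      refine iff_of_false ?_ id
      rintro ⟨-, -, h, -⟩
      omega
  refine ⟨X, Y, hXY, ⟨⟨Nat.one_pos, fun j h1 h2 => by omega, False.elim, False.elim⟩,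
    fun _ _ => id, fun x _ y _ h => h.elim⟩, ⟨⟨Nat.two_pos, fun j h1 h2 => by omega, False.elim,
    fun h => h.2.1.le⟩, fun x y h => by simpa using h.1, ?_⟩, ?_, ?_⟩
  · rintro x _ y _ ⟨-, -, rfl, -⟩
    exact ⟨fun _ => ⟨Nat.le_succ x, x.succ_ne_self.symm⟩,
      fun z _ _ => (Nat.lt_or_ge x z).symm⟩
  · refine ⟨Or.inl rfl, ⟨Nat.zero_le _, by decide⟩, fun z _ _ h => ?_⟩
    have h1 : z ≤ 2 ∧ z ≠ 2 := h
    exact ⟨z + 1, ⟨Nat.le_succ z, z.succ_ne_self.symm⟩, show z + 1 ≤ 2 by omega,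
      rfl, rfl, rfl, by omega⟩
  · rintro ⟨-, -, h⟩
    obtain ⟨w, -, -, h⟩ := h 0 (Or.inl rfl) le_rfl ⟨Nat.zero_le _, by decide⟩
    exact h

/-- Adds `R_{i+1}` between the endpoints. -/
def addR (i : ℕ) (X : Word) : Word := X.decorate (fun b j => b = false ∧ j = i) (fun _ => False)

theorem spares_addR (i : ℕ) : Spares i (fun b j => b = false ∧ j = i) (fun _ => False) :=
  ⟨fun _ _ => id, fun _ _ h => by simpa using h.1, fun j hj h => hj.ne h.2⟩

theorem IsLevel.addR {X : Word} (h : X.IsLevel i) : (X.addR i).IsLevel i where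
  pos := h.pos
  mark j h1 h2 := ⟨Or.inl (h.mark j h1 h2).1, Or.inl (h.mark j h1 h2).2⟩
  P_level := by
    rintro j x (h' | h')
    · exact h.P_level h'
    · exact h'.1.elim
  bin_level := by
    rintro b j x y (h' | h')
    · exact h.bin_level h'
    · exact h'.1.2.le

theorem PlainPair.mainPair (h : PlainPair n k i) : MainPair n k i := by
  obtain ⟨X, Y, hle, hX, hY, hYt, hXt⟩ := h
  obtain ⟨s, t, u, hpump⟩ := hle.pump
  have hYpow : ∀ s, (Y ^ (s + 1)).IsPlain i :=
    pow_induction (C := IsPlain i) (fun _ _ => IsPlain.mul) hY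
  have hB := ((hYpow t).mul hX).mul (hYpow u)
  have hBt : ¬ (Y ^ (t + 1) * X * Y ^ (u + 1)).IsTotal i := by
    rw [isTotal_mul ((hYpow t).mul hX).level (hYpow u).level,
      isTotal_mul (hYpow t).level hX.level]
    exact fun h => hXt h.1.2
  refine ⟨(Y ^ (s + 1)).addR i, (Y ^ (t + 1) * X * Y ^ (u + 1)).addR i, Leq.decorate hpump,
    (hYpow s).level.addR, hB.level.addR, Or.inr ⟨⟨rfl, rfl⟩, rfl, rfl, (hYpow s).level.pos⟩,
    (tot_decorate (spares_addR i)).2 (isTotal_pow hY.level hYt s).2,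
    (isPartial_decorate (spares_addR i)).2 hB.isPartial, ?_⟩
  rintro ⟨x, y, h | ⟨-, rfl, rfl, -⟩, hT⟩
  · exact hB.no_R _ _ h
  · exact hBt ((tot_decorate (spares_addR i)).1 hT)

/-- Adds `P_{i+1}` at the endpoints and `S_{i+1}` between them. -/
def addS (i : ℕ) (X : Word) : Word := X.decorate (fun b j => b = true ∧ j = i) (fun j => j = i)

theorem spares_addS (i : ℕ) :
    Spares i (fun b j => b = true ∧ j = i + 1) (fun j => j = i + 1) :=
  ⟨fun j hj h => by omega, fun j hj h => by omega, fun j hj h => by simpa using h.1⟩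

theorem IsLevel.isPlain_addS {X : Word} (h : X.IsLevel i) : (X.addS (i + 1)).IsPlain (i + 1) where
  level :=
    { pos := h.pos
      mark := by
        intro j h1 h2
        rcases Nat.lt_or_ge i j with h3 | h3
        · exact ⟨Or.inr ⟨by omega, Or.inl rfl⟩, Or.inr ⟨by omega, Or.inr rfl⟩⟩
        · exact ⟨Or.inl (h.mark j h1 h3).1, Or.inl (h.mark j h1 h3).2⟩
      P_level := by
        rintro j x (h' | ⟨rfl, _⟩)
        · have := h.P_level h'
          omega
        · omega
      bin_level := by
        rintro b j x y (h' | ⟨⟨-, rfl⟩, -⟩)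
        · have := h.bin_level h'
          omega
        · exact le_rfl }
  no_R := by
    rintro x y (h' | h')
    · have := h.bin_level h'
      omega
    · simpa using h'.1.1
  isPartial := by
    intro x _ y _ hxy
    refine ⟨fun h' => by omega, fun z hz hPz => ?_⟩
    rcases hxy.bin with h' | ⟨-, rfl, rfl, -⟩
    · have := h.bin_level h'
      omega
    · rcases hPz with h' | h' | ⟨-, h' | h'⟩
      · omega
      · have := h.P_level h'
        omega
      · exact Or.inl h'.le
      · exact Or.inr h'.ge

theorem IsLevel.isTotal_addS {X : Word} (h : X.IsLevel i) :
    (X.addS (i + 1)).IsTotal (i + 1) ↔ X.rels.STR i (Set.Iic X.len) := by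
  have hne : (X.addS (i + 1)).rels.lt 0 X.len := ⟨Nat.zero_le _, h.pos.ne⟩
  have hP0 : (X.addS (i + 1)).P (i + 1) 0 := Or.inr ⟨rfl, Or.inl rfl⟩
  have hIcc : id '' Set.Iic X.len = (X.addS (i + 1)).rels.Icc 0 X.len := by
    ext z
    simp [Rels.Icc, rels]
  have hloc : (X.addS (i + 1)).rels.STR i (id '' Set.Iic X.len) ↔ X.rels.STR i (Set.Iic X.len) :=
    str_decorate (spares_addS i) (fun h' => by simpa using h'.1) _
  rw [← hloc, hIcc]
  constructor
  · rintro ⟨-, -, hT⟩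
    obtain ⟨w, -, -, hw⟩ := hT 0 (Or.inr hP0) le_rfl hne
    rcases hw.bin with h' | ⟨-, -, rfl, -⟩
    · have := h.bin_level h'
      omega
    · exact hw.2.2.2.2
  · intro hS
    refine ⟨Or.inr hP0, hne, fun z hz h1 h2 => ?_⟩
    -- the left endpoint is the only marked element below the right endpoint
    obtain rfl : z = 0 := by
      rcases hz with h' | h' | ⟨-, h' | h'⟩
      · omega
      · have := h.P_level h'
        omega
      · exact h'
      · exact absurd h' h2.2
    exact ⟨X.len, hne, le_rfl, hP0, Or.inr ⟨rfl, Or.inr rfl⟩,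
      Or.inr ⟨⟨rfl, rfl⟩, rfl, rfl, h.pos⟩, Nat.zero_le _, hS⟩

theorem MainPair.plainPair (h : MainPair n k i) : PlainPair n k (i + 1) := by
  obtain ⟨A, B, hle, hA, hB, hAR, hAt, hBp, hBt⟩ := h
  obtain ⟨s, t, u, hpump⟩ := hle.pump
  have hBpow : ∀ s, (B ^ (s + 1)).IsLevel i ∧ (B ^ (s + 1)).IsPartial i ∧
      ¬ (B ^ (s + 1)).HasTotal i :=
    pow_induction (C := fun X => X.IsLevel i ∧ X.IsPartial i ∧ ¬ X.HasTotal i)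
      (fun X Y hX hY => ⟨hX.1.mul hY.1, hX.2.1.mul hX.1 hY.1 hY.2.1, by
        rw [hasTotal_mul hX.1 hY.1]
        exact not_or.2 ⟨hX.2.2, hY.2.2⟩⟩) ⟨hB, hBp, hBt⟩
  have hY := ((hBpow t).1.mul hA).mul (hBpow u).1
  have hYt : (B ^ (t + 1) * A * B ^ (u + 1)).HasTotal i := by
    rw [hasTotal_mul ((hBpow t).1.mul hA) (hBpow u).1, hasTotal_mul (hBpow t).1 hA]
    exact Or.inl (Or.inr ⟨0, A.len, hAR, hAt⟩)
  refine ⟨(B ^ (s + 1)).addS (i + 1), (B ^ (t + 1) * A * B ^ (u + 1)).addS (i + 1),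
    Leq.decorate hpump, (hBpow s).1.isPlain_addS, hY.isPlain_addS, ?_, ?_⟩
  · rw [hY.isTotal_addS, str_iff]
    exact Or.inr hYt
  · rw [(hBpow s).1.isTotal_addS, str_iff]
    exact not_or.2 ⟨not_not.2 (hBpow s).2.1, (hBpow s).2.2⟩

theorem mainPair (n k i : ℕ) : MainPair n k i := by
  induction i with
  | zero => exact (plainPair_zero n k).mainPair
  | succ i ih => exact ih.plainPair.mainPair

end Construction

/-! ### Failure of `Σ_{2n}`-definability -/

attribute [local instance] Word.str

theorem not_exists_isSigma (i : ℕ) : ¬ ∃ ψ : (SigC (i + 1)).Sentence,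
    IsSigma (2 * (i + 1)) ψ ∧ EquivFiniteOn (orderedMinMax (i + 1)) (phi (i + 1)) ψ := by
  rintro ⟨ψ, hψ, heq⟩
  obtain ⟨k, hk⟩ := exists_le_imp_realize hψ
  obtain ⟨A, B, hle, hA, hB, hAR, hAt, hBp, hBt⟩ := mainPair (i + 1) k i
  have hP : ∀ {X : Word}, X.IsLevel i → ∀ x, ¬ X.P 0 x :=
    fun hX x h => absurd (hX.P_level h).1 (lt_irrefl 0)
  have hfin : ∀ X : Word, Finite X.Carrier := fun X => (Set.finite_Iic X.len).to_subtype
  have hAφ : A.Carrier ⊨ phi (i + 1) := (realize_phi A (hP hA)).2 (Or.inr ⟨hAR, hAt⟩)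
  have hBφ : ¬ B.Carrier ⊨ phi (i + 1) := by
    rw [realize_phi B (hP hB)]
    rintro (h | h)
    · exact h hBp
    · exact hBt ⟨0, B.len, h⟩
  have := hfin A
  have := hfin B
  exact hBφ ((heq _ (realize_orderedMinMax B)).2
    (hk A B hle ((heq _ (realize_orderedMinMax A)).1 hAφ)))

end Word

/-! ### Embeddings of structures and the prenex form -/

/-- An embedding of structures is an embedding of their relations. -/
theorem emb_toRelsC {n : ℕ} {A B : Type} [(SigC n).Structure A] [(SigC n).Structure B]
    (f : A ↪[SigC n] B) : Rels.Emb (toRelsC n A) (toRelsC n B) f := by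
  have h₂ : ∀ (r : (SigC n).Relations 2) (x y : A),
      Structure.RelMap r ![f x, f y] ↔ Structure.RelMap r ![x, y] := by
    intro r x y
    rw [← f.map_rel r ![x, y], show ![f x, f y] = f ∘ ![x, y] by
      funext i; fin_cases i <;> rfl]
  have h₁ : ∀ (r : (SigC n).Relations 1) (x : A),
      Structure.RelMap r ![f x] ↔ Structure.RelMap r ![x] := by
    intro r x
    rw [← f.map_rel r ![x], show ![f x] = f ∘ ![x] by
      funext i; fin_cases i; rfl]
  exact ⟨f.injective, fun x y => h₂ (Sum.inl (leSym n)) x y,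
    fun b i x y => exists_congr fun h => h₂ (Sum.inl (if b then SigRel.S (i + 1) i.succ_pos h
      else SigRel.R (i + 1) i.succ_pos h : SigRel n 2)) x y,
    fun i x => exists_congr fun h => exists_congr fun h' =>
      h₁ (Sum.inl (SigRel.P (i + 1) h h' : SigRel n 1)) x⟩

theorem map_endpt {n : ℕ} {A B : Type} [(SigC n).Structure A] [(SigC n).Structure B]
    (f : A ↪[SigC n] B) (i : Fin 2) : f (endpt n A i) = endpt n B i :=
  f.toHom.map_constants _

theorem extensionClosed_phi (i : ℕ) : ExtensionClosed (phi (i + 1)) := by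
  intro A B _ _ _ _ f hA
  rw [realize_phi] at hA ⊢
  rw [← map_endpt f, ← map_endpt f]
  exact (emb_toRelsC f).phi hA

theorem exists_isPi (i : ℕ) : ∃ φ : (SigC (i + 1)).Sentence, IsPi (2 * (i + 1)) φ ∧
    ∀ (M : Type) [(SigC (i + 1)).Structure M], M ⊨ φ ↔ M ⊨ phi (i + 1) := by
  obtain ⟨φ, h1, h2⟩ := defBy_phi i
  refine ⟨φ, h1, fun M _ => ?_⟩
  have : Nonempty M := ⟨endpt (i + 1) M 0⟩
  rw [realize_phi]
  exact h2 M _ _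

end ExtPres

theorem mainTheorem3 (n : ℕ) (hn : 1 ≤ n) :
    ∃ φ : (ExtPres.SigC n).Sentence,
      ExtPres.IsPi (2 * n) φ ∧
      (∅ : (ExtPres.SigC n).Theory).Iff φ (ExtPres.phi n) ∧
      ExtPres.ExtensionClosed φ ∧
      (¬ ∃ ψ : (ExtPres.SigC n).Sentence,
        ExtPres.IsSigma (2 * n) ψ ∧ ExtPres.EquivFinite φ ψ) ∧
      (¬ ∃ ψ : (ExtPres.SigC n).Sentence,
        ExtPres.IsSigma (2 * n) ψ ∧
          ExtPres.EquivFiniteOn (ExtPres.orderedMinMax n) φ ψ) := by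
  obtain ⟨i, rfl⟩ : ∃ i, n = i + 1 := ⟨n - 1, by omega⟩
  obtain ⟨φ, hφ, heq⟩ := ExtPres.exists_isPi i
  have hlow : ¬ ∃ ψ : (ExtPres.SigC (i + 1)).Sentence, ExtPres.IsSigma (2 * (i + 1)) ψ ∧
      ExtPres.EquivFiniteOn (ExtPres.orderedMinMax (i + 1)) φ ψ := by
    rintro ⟨ψ, hψ, h⟩
    exact ExtPres.Word.not_exists_isSigma i
      ⟨ψ, hψ, fun A _ _ hA => (heq A).symm.trans (h A hA)⟩
  refine ⟨φ, hφ, fun M v xs => ?_, fun A B _ _ _ _ f hA => ?_, ?_, hlow⟩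
  · have := heq M
    simp only [Sentence.Realize, Formula.Realize] at this
    rw [BoundedFormula.realize_iff, Subsingleton.elim v default, Subsingleton.elim xs default]
    exact this
  · exact (heq B).2 (ExtPres.extensionClosed_phi i A B f ((heq A).1 hA))
  · rintro ⟨ψ, hψ, h⟩
    exact hlow ⟨ψ, hψ, fun A _ _ _ => h A⟩
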